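/- Let $k\geqslant 1$ be an integer and put $\gamma_k=\sum_{j=1}^{k}1/j$. A function $f:\mathbb{R}\to\mathbb{R}$ is called $k$-concordant if for all sufficiently large positive integers $m_0,\ldots,m_k$ (not necessarily distinct) there is a polynomial $P\in\mathbb{Z}[X]$ such that $P(m_i)=f(m_i)$ for all $i=0,\ldots,k$. Let $\Delta f(x)=f(x+1)-f(x)$, and let $\Delta^n$ denote the $n$-th iterate of $\Delta$. Suppose that $f:\mathbb{R}\to\mathbb{R}$ is $k$-concordant. Then there are a real number $c>0$ and a positive integer $B$ such that for all integers $a\geqslant B$ and all integers $n\geqslant 2$, $$|\Delta^n f(a)|\ \geqslant\ e^{\gamma_k n-cn/\log(n)}\qquad\text{or}\qquad \Delta^n f(a)=0.$$ -/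

import Mathlib

/-- A function `f : ℝ → ℝ` is `k`-concordant if for all sufficiently large positive integers
`m 0, ..., m k` (not necessarily distinct) there is a polynomial with integer coefficients that
agrees with `f` at each `m i`. -/
def IsConcordant (k : ℕ) (f : ℝ → ℝ) : Prop :=
  ∃ B : ℕ, 1 ≤ B ∧ ∀ m : Fin (k + 1) → ℕ, (∀ i, B ≤ m i) →
    ∃ P : Polynomial ℤ, ∀ i, ((P.eval (m i : ℤ) : ℤ) : ℝ) = f (m i : ℝ)

/-! From `B` on, f is integer-valued, and an iterated difference of order i ≤ k with step h uses
only i + 1 ≤ k + 1 points. It is therefore a difference of an integer polynomial, hence divisible by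
h ^ i (`pow_dvd_fwdDiff_iter_of_concordant`). For a prime p, the congruence Δ^p ≡ (1 + Δ)^p - 1
modulo pΔ compares Δ^p with the difference of step p, so p ^ j divides Δ^n f(a) whenever j ≤ k and
pj ≤ n (`prime_pow_dvd_fwdDiff_iter`).

Multiplying over primes gives a divisor of Δ^n f(a) whose logarithm is the sum of θ(n/j) over 1 ≤ j
≤ k (`log_prod_prime_pow`). A nonzero integer is at least its divisor in absolute value, so θ(x) ≥ x
- Cx/log x suffices.

That form of the prime number theorem is `exists_sub_le_theta`, and most of the file proves it. The
3-4-1 inequality gives a zero-free region whose width is a small negative power of the height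
(`exists_le_norm_riemannZeta`). There the second derivative of -ζ'/ζ - ζ is O(|t|^(1/2)) up to re s
= 1, and a smoothed Perron formula turns this into a bound for sums of (Λ(n) - 1)(log n)². The two
logarithms become the saving in the error term. -/

/-! ### Euler–Maclaurin continuation of (s - 1)ζ(s) to re s > 0. -/

section ZetaStep

open Complex Filter Topology Finset

/-- The `n`-th error term in the Euler–Maclaurin expansion of `(s - 1) ζ(s)`. -/
noncomputable def zetaStep (n : ℕ) (s : ℂ) : ℂ :=
  (s - 1) * ((n : ℂ) + 1) ^ (-s) + ((n : ℂ) + 1) ^ (1 - s) - (n : ℂ) ^ (1 - s)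

lemma norm_zetaStep_le {n : ℕ} (hn : 1 ≤ n) {s : ℂ} {δ : ℝ} (hδ : 0 < δ) (hs : δ ≤ s.re) :
    ‖zetaStep n s‖ ≤ ‖s‖ * ‖s - 1‖ / δ * ((n : ℝ) ^ (-δ) - ((n : ℝ) + 1) ^ (-δ)) := by
  have hn0 : (1 : ℝ) ≤ n := by exact_mod_cast hn
  -- `zetaStep n s` is Φ(n + 1) - Φ(n). The linear factor u - n makes the u^(-s) terms of Φ' cancel,
  -- leaving decay of order u^(-re s - 1), whose integral telescopes.
  set Φ : ℝ → ℂ := fun u ↦ (s - 1) * ((u - n) * (u : ℂ) ^ (-s)) + (u : ℂ) ^ (1 - s) with hΦ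
  set Φ' : ℝ → ℂ := fun u ↦ -s * (s - 1) * ((u - n) * (u : ℂ) ^ (-s - 1)) with hΦ'
  set K := ‖s‖ * ‖s - 1‖ / δ with hK
  have hder : ∀ u : ℝ, 0 < u → HasDerivAt Φ (Φ' u) u := by
    intro u hu
    have hu' : (u : ℂ) ∈ slitPlane := by simp [slitPlane, hu]
    have hu0 : (u : ℂ) ≠ 0 := by exact_mod_cast hu.ne'
    have h1 : HasDerivAt (fun x : ℝ ↦ (x : ℂ) ^ (-s)) (-s * (u : ℂ) ^ (-s - 1) * 1) u :=
      ((hasDerivAt_id (u : ℂ)).cpow_const hu').comp_ofReal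
    have h2 : HasDerivAt (fun x : ℝ ↦ (x : ℂ) ^ (1 - s)) ((1 - s) * (u : ℂ) ^ (1 - s - 1) * 1) u :=
      ((hasDerivAt_id (u : ℂ)).cpow_const hu').comp_ofReal
    have h3 := ((((hasDerivAt_id (u : ℂ)).comp_ofReal.sub_const (n : ℂ)).mul h1).const_mul (s - 1)).add h2
    refine h3.congr_deriv ?_
    have e1 : (u : ℂ) ^ (1 - s - 1) = (u : ℂ) ^ (-s) := by congr 1; ring
    simp only [hΦ', e1, id]
    ring
  have hB : ∀ u : ℝ, 0 < u → HasDerivAt (fun u : ℝ ↦ K * ((n : ℝ) ^ (-δ) - u ^ (-δ)))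
      (K * (δ * u ^ (-δ - 1))) u := by
    intro u hu
    have := ((Real.hasDerivAt_rpow_const (p := -δ) (Or.inl hu.ne')).const_sub
      ((n : ℝ) ^ (-δ))).const_mul K
    exact this.congr_deriv (by ring)
  have key := image_norm_le_of_norm_deriv_right_le_deriv_boundary'
    (a := (n : ℝ)) (b := (n : ℝ) + 1) (f := fun u ↦ Φ u - Φ n) (f' := Φ')
    (B := fun u : ℝ ↦ K * ((n : ℝ) ^ (-δ) - u ^ (-δ))) (B' := fun u ↦ K * (δ * u ^ (-δ - 1)))
    (fun u hu ↦ ((hder u (by linarith [hu.1])).sub_const _).continuousAt.continuousWithinAt)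
    (fun u hu ↦ ((hder u (by linarith [hu.1])).sub_const _).hasDerivWithinAt)
    (by simp)
    (fun u hu ↦ (hB u (by linarith [hu.1])).continuousAt.continuousWithinAt)
    (fun u hu ↦ (hB u (by linarith [hu.1])).hasDerivWithinAt)
    (by
      intro u hu
      have hu1 : 1 ≤ u := hn0.trans hu.1
      have hu0 : 0 < u := by linarith
      simp only [hΦ', hK, norm_mul, norm_neg]
      rw [norm_cpow_eq_rpow_re_of_pos hu0]
      have h1 : ‖(u : ℂ) - n‖ ≤ 1 := by
        have : (u : ℂ) - n = ((u - n : ℝ) : ℂ) := by push_cast; ring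
        rw [this, norm_real, Real.norm_eq_abs, abs_le]
        constructor <;> linarith [hu.1, hu.2]
      have h2 : u ^ (-s - 1).re ≤ u ^ (-δ - 1) := by
        apply Real.rpow_le_rpow_of_exponent_le hu1
        simp; linarith
      calc ‖s‖ * ‖s - 1‖ * (‖(u : ℂ) - n‖ * u ^ (-s - 1).re)
          ≤ ‖s‖ * ‖s - 1‖ * (1 * u ^ (-δ - 1)) := by gcongr
        _ = _ := by field_simp)
    (x := (n : ℝ) + 1) ⟨by linarith, le_rfl⟩
  refine le_trans (le_of_eq ?_) key
  simp only [zetaStep, hΦ]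
  congr 1
  push_cast
  ring

lemma hasSum_telescope_rpow {N : ℕ} (hN : 1 ≤ N) {δ : ℝ} (hδ : 0 < δ) :
    HasSum (fun i : ℕ ↦ ((N + i : ℕ) : ℝ) ^ (-δ) - (((N + i : ℕ) : ℝ) + 1) ^ (-δ))
      ((N : ℝ) ^ (-δ)) := by
  rw [hasSum_iff_tendsto_nat_of_nonneg]
  · have h : ∀ m : ℕ, ∑ i ∈ range m, (((N + i : ℕ) : ℝ) ^ (-δ) - (((N + i : ℕ) : ℝ) + 1) ^ (-δ))
        = (N : ℝ) ^ (-δ) - ((N + m : ℕ) : ℝ) ^ (-δ) := by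
      intro m
      have := Finset.sum_range_sub' (fun i : ℕ ↦ ((N + i : ℕ) : ℝ) ^ (-δ)) m
      simpa [add_assoc] using this
    simp_rw [h]
    have : Tendsto (fun m : ℕ ↦ ((N + m : ℕ) : ℝ) ^ (-δ)) atTop (𝓝 0) :=
      ((tendsto_rpow_neg_atTop hδ).comp tendsto_natCast_atTop_atTop).comp
        (tendsto_atTop_mono (fun m ↦ Nat.le_add_left m N) tendsto_id)
    simpa using this.const_sub ((N : ℝ) ^ (-δ))
  · intro i
    have : (0 : ℝ) < ((N + i : ℕ) : ℝ) := by positivity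
    rw [sub_nonneg]
    exact Real.rpow_le_rpow_of_nonpos this (by linarith) (by linarith)

lemma norm_zetaStep_tail_le {N : ℕ} (hN : 1 ≤ N) {s : ℂ} (hs : 0 < s.re) :
    ‖∑' i : ℕ, zetaStep (N + i) s‖ ≤ ‖s‖ * ‖s - 1‖ / s.re * (N : ℝ) ^ (-s.re) :=
  tsum_of_norm_bounded ((hasSum_telescope_rpow hN hs).mul_left _)
    fun i ↦ norm_zetaStep_le (by omega) hs le_rfl

lemma differentiable_zetaStep {n : ℕ} (hn : 1 ≤ n) : Differentiable ℂ (zetaStep n) := by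
  have h1 : (n : ℂ) ≠ 0 := by exact_mod_cast (by omega : n ≠ 0)
  have h2 : (n : ℂ) + 1 ≠ 0 := by exact_mod_cast (by omega : n + 1 ≠ 0)
  unfold zetaStep
  intro s
  have a1 : DifferentiableAt ℂ (fun s : ℂ ↦ ((n : ℂ) + 1) ^ (-s)) s :=
    (differentiableAt_id.neg).const_cpow (Or.inl h2)
  have a2 : DifferentiableAt ℂ (fun s : ℂ ↦ ((n : ℂ) + 1) ^ (1 - s)) s :=
    (differentiableAt_id.const_sub 1).const_cpow (Or.inl h2)
  have a3 : DifferentiableAt ℂ (fun s : ℂ ↦ (n : ℂ) ^ (1 - s)) s :=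
    (differentiableAt_id.const_sub 1).const_cpow (Or.inl h1)
  exact (((differentiableAt_id.sub_const 1).mul a1).add a2).sub a3

lemma riemannZeta₁_eq_of_one_lt_re {N : ℕ} (hN : 1 ≤ N) {s : ℂ} (hs : 1 < s.re) :
    riemannZeta₁ s = (s - 1) * ∑ n ∈ range N, ((n : ℂ) + 1) ^ (-s) + (N : ℂ) ^ (1 - s)
      + ∑' i : ℕ, zetaStep (N + i) s := by
  have hs1 : s ≠ 1 := by rintro rfl; simp at hs
  have hsum : Summable fun i : ℕ ↦ zetaStep (N + i) s :=
    .of_norm_bounded ((hasSum_telescope_rpow hN (zero_lt_one.trans hs)).mul_left _).summable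
      fun i ↦ norm_zetaStep_le (by omega) (zero_lt_one.trans hs) le_rfl
  have hpart : ∀ m : ℕ, ∑ i ∈ range m, zetaStep (N + i) s =
      (s - 1) * (∑ n ∈ range (N + m), ((n : ℂ) + 1) ^ (-s) - ∑ n ∈ range N, ((n : ℂ) + 1) ^ (-s))
        + ((N + m : ℕ) : ℂ) ^ (1 - s) - (N : ℂ) ^ (1 - s) := by
    intro m
    induction m with
    | zero => simp
    | succ m ih =>
      rw [sum_range_succ, ih, ← add_assoc N m 1, sum_range_succ _ (N + m), zetaStep]
      push_cast
      ring
  have hz : Tendsto (fun m : ℕ ↦ ∑ n ∈ range (N + m), ((n : ℂ) + 1) ^ (-s)) atTop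
      (𝓝 (riemannZeta s)) := by
    have hsm : Summable fun n : ℕ ↦ 1 / ((n : ℂ) + 1) ^ s := by
      have := (summable_nat_add_iff 1).mpr (Complex.summable_one_div_nat_cpow.mpr hs)
      simpa using this
    have := hsm.hasSum.tendsto_sum_nat
    rw [← zeta_eq_tsum_one_div_nat_add_one_cpow hs] at this
    have h2 := this.comp (tendsto_atTop_mono (fun m ↦ Nat.le_add_left m N) tendsto_id)
    refine h2.congr fun m ↦ ?_
    simp [cpow_neg]
  have h0 : Tendsto (fun m : ℕ ↦ ((N + m : ℕ) : ℂ) ^ (1 - s)) atTop (𝓝 0) := by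
    rw [tendsto_zero_iff_norm_tendsto_zero]
    have h1 : Tendsto (fun m : ℕ ↦ ((N + m : ℕ) : ℝ) ^ (-(s.re - 1))) atTop (𝓝 0) :=
      ((tendsto_rpow_neg_atTop (by linarith)).comp tendsto_natCast_atTop_atTop).comp
        (tendsto_atTop_mono (fun m ↦ Nat.le_add_left m N) tendsto_id)
    refine h1.congr fun m ↦ ?_
    rw [norm_natCast_cpow_of_pos (by omega)]
    simp
  have hlim := (((hz.sub_const (∑ n ∈ range N, ((n : ℂ) + 1) ^ (-s))).const_mul (s - 1)).add
    h0).sub_const ((N : ℂ) ^ (1 - s))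
  have heq := tendsto_nhds_unique hsum.hasSum.tendsto_sum_nat (hlim.congr fun m ↦ (hpart m).symm)
  rw [heq]
  rw [riemannZeta_eq_inv_sub_mul hs1]
  have : s - 1 ≠ 0 := sub_ne_zero.mpr hs1
  field_simp
  ring

/-- Both sides are analytic on the convex set `U`, by locally uniform convergence of the tail, and
agree near the real point ‖s‖ + 2, where the Dirichlet series converges. The identity theorem does
the rest. -/
lemma riemannZeta₁_eq {N : ℕ} (hN : 1 ≤ N) {s : ℂ} (hs : 0 < s.re) :
    riemannZeta₁ s = (s - 1) * ∑ n ∈ range N, ((n : ℂ) + 1) ^ (-s) + (N : ℂ) ^ (1 - s)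
      + ∑' i : ℕ, zetaStep (N + i) s := by
  set δ := s.re / 2 with hδ
  have hδ0 : 0 < δ := by positivity
  set K := ‖s‖ + 3 with hK
  set U : Set ℂ := {z | δ < z.re} ∩ Metric.ball 0 K with hU
  have hUo : IsOpen U := (isOpen_lt continuous_const continuous_re).inter Metric.isOpen_ball
  have hUc : Convex ℝ U := (convex_halfSpace_re_gt δ).inter (convex_ball 0 K)
  have hdiff : DifferentiableOn ℂ (fun z ↦ ∑' i : ℕ, zetaStep (N + i) z) U := by
    refine differentiableOn_tsum_of_summable_norm (u := fun i ↦ K * (K + 1) / δ *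
      (((N + i : ℕ) : ℝ) ^ (-δ) - (((N + i : ℕ) : ℝ) + 1) ^ (-δ)))
      ((hasSum_telescope_rpow hN hδ0).mul_left _).summable
      (fun i ↦ (differentiable_zetaStep (by omega)).differentiableOn) hUo ?_
    intro i w hw
    have hw1 : δ < w.re := hw.1
    have hw2 : ‖w‖ < K := by simpa using hw.2
    refine (norm_zetaStep_le (by omega) hδ0 hw1.le).trans ?_
    have hpos : 0 ≤ ((N + i : ℕ) : ℝ) ^ (-δ) - (((N + i : ℕ) : ℝ) + 1) ^ (-δ) := by
      have : (0 : ℝ) < ((N + i : ℕ) : ℝ) := by positivity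
      rw [sub_nonneg]
      exact Real.rpow_le_rpow_of_nonpos this (by linarith) (by linarith)
    have h1 : ‖w - 1‖ ≤ K + 1 := (norm_sub_le _ _).trans (by simpa using hw2.le)
    have : 0 ≤ K := by positivity
    gcongr
  have hN0 : (N : ℂ) ≠ 0 := by exact_mod_cast (by omega : N ≠ 0)
  have hd2 : Differentiable ℂ fun z : ℂ ↦
      (z - 1) * ∑ n ∈ range N, ((n : ℂ) + 1) ^ (-z) + (N : ℂ) ^ (1 - z) := by
    intro z
    have a1 : ∀ n ∈ range N, DifferentiableAt ℂ (fun z : ℂ ↦ ((n : ℂ) + 1) ^ (-z)) z := fun n _ ↦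
      (differentiableAt_id.neg).const_cpow (Or.inl (by exact_mod_cast (by omega : n + 1 ≠ 0)))
    have a3 : DifferentiableAt ℂ (fun s : ℂ ↦ (N : ℂ) ^ (1 - s)) z :=
      (differentiableAt_id.const_sub 1).const_cpow (Or.inl hN0)
    exact ((differentiableAt_id.sub_const 1).mul (DifferentiableAt.fun_sum a1)).add a3
  have hd3 := hd2.differentiableOn.add hdiff
  have ha1 : AnalyticOnNhd ℂ riemannZeta₁ U :=
    differentiable_riemannZeta₁.differentiableOn.analyticOnNhd hUo
  have ha2 := hd3.analyticOnNhd hUo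
  have h2U : (((‖s‖ + 2 : ℝ)) : ℂ) ∈ U := by
    refine ⟨?_, ?_⟩
    · have := Complex.re_le_norm s
      simp only [Set.mem_ofPred_eq, ofReal_re, hδ]
      linarith [norm_nonneg s]
    · rw [mem_ball_zero_iff, norm_real, Real.norm_of_nonneg (by positivity)]
      linarith
  refine ha1.eqOn_of_preconnected_of_eventuallyEq ha2 hUc.isPreconnected h2U ?_ ⟨?_, ?_⟩
  · have : {z : ℂ | 1 < z.re} ∈ 𝓝 (((‖s‖ + 2 : ℝ)) : ℂ) := by
      apply (isOpen_lt continuous_const continuous_re).mem_nhds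
      simp only [Set.mem_ofPred_eq, ofReal_re]
      linarith [norm_nonneg s]
    filter_upwards [this] with z hz
    exact riemannZeta₁_eq_of_one_lt_re hN hz
  · simp only [Set.mem_ofPred_eq, hδ]; linarith
  · rw [mem_ball_zero_iff]; linarith

end ZetaStep

/-! ### Upper bounds for ζ near the line re s = 1. -/

section ZetaBounds

open Complex Filter Topology Finset

lemma norm_riemannZeta_le_sum {N : ℕ} (hN : 1 ≤ N) {s : ℂ} (hs : 0 < s.re) (ht : 1 ≤ |s.im|) :
    ‖riemannZeta s‖ ≤ ∑ n ∈ range N, ((n : ℝ) + 1) ^ (-s.re) + (N : ℝ) ^ (1 - s.re)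
      + ‖s‖ / s.re * (N : ℝ) ^ (-s.re) := by
  have hs1 : s ≠ 1 := by rintro rfl; norm_num at ht
  have hd : 1 ≤ ‖s - 1‖ := ht.trans (by simpa using abs_im_le_norm (s - 1))
  have hd0 : 0 < ‖s - 1‖ := by linarith
  have hs0 : s - 1 ≠ 0 := sub_ne_zero.mpr hs1
  rw [riemannZeta_eq_inv_sub_mul hs1, riemannZeta₁_eq hN hs, norm_mul, norm_inv,
    inv_mul_le_iff₀ hd0]
  have h1 : ‖∑ n ∈ range N, ((n : ℂ) + 1) ^ (-s)‖ ≤ ∑ n ∈ range N, ((n : ℝ) + 1) ^ (-s.re) := by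
    refine norm_sum_le_of_le _ fun n _ ↦ le_of_eq ?_
    have := norm_natCast_cpow_of_pos (n := n + 1) (by omega) (-s)
    simpa using this
  have h2 : ‖(N : ℂ) ^ (1 - s)‖ = (N : ℝ) ^ (1 - s.re) := by
    simpa using norm_natCast_cpow_of_pos (n := N) (by omega) (1 - s)
  have h3 := norm_zetaStep_tail_le hN hs
  have h4 : 0 ≤ (N : ℝ) ^ (1 - s.re) := by positivity
  calc _ ≤ ‖s - 1‖ * ∑ n ∈ range N, ((n : ℝ) + 1) ^ (-s.re) + (N : ℝ) ^ (1 - s.re) +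
        ‖s‖ * ‖s - 1‖ / s.re * (N : ℝ) ^ (-s.re) := by
        refine (norm_add₃_le).trans ?_
        rw [norm_mul, h2]
        gcongr
    _ ≤ ‖s - 1‖ * ∑ n ∈ range N, ((n : ℝ) + 1) ^ (-s.re) + ‖s - 1‖ * (N : ℝ) ^ (1 - s.re) +
        ‖s‖ * ‖s - 1‖ / s.re * (N : ℝ) ^ (-s.re) := by
        gcongr
        nlinarith
    _ = _ := by ring

lemma exists_norm_riemannZeta_le {ε : ℝ} (hε : 0 < ε) (hε1 : ε ≤ 1) :
    ∃ C : ℝ, 1 ≤ C ∧ ∀ T : ℝ, 1 ≤ T → ∀ s : ℂ, 1 - ε / 2 ≤ s.re → s.re ≤ 3 → 1 ≤ |s.im| →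
      |s.im| ≤ T → ‖riemannZeta s‖ ≤ C * T ^ ε := by
  set η := ε / 2 with hη
  have hη0 : 0 < η := by positivity
  refine ⟨2 * (10 + 1 / η), by have : 0 < 1 / η := (by positivity); linarith, ?_⟩
  intro T hT s hs1 hs3 ht htT
  -- Truncating at the height makes ‖s‖ N^(-σ) comparable to N^(1-σ). One factor N^η pays for σ
  -- falling below 1 and another for the logarithm of the harmonic sum; together they give T^ε.
  set N := ⌈T⌉₊ with hN
  have hTN : T ≤ N := Nat.le_ceil T
  have hN1 : (1 : ℝ) ≤ N := hT.trans hTN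
  have hN1' : 1 ≤ N := by exact_mod_cast hN1
  have hN2 : (N : ℝ) ≤ 2 * T := by
    have := Nat.ceil_lt_add_one (by linarith : 0 ≤ T)
    linarith
  have hσ : 1 / 2 ≤ s.re := by linarith
  have hN0 : (0 : ℝ) < N := by linarith
  set Y := (N : ℝ) ^ η with hY
  have hY1 : 1 ≤ Y := Real.one_le_rpow hN1 hη0.le
  have hsum : ∑ n ∈ range N, ((n : ℝ) + 1) ^ (-s.re) ≤ Y * (1 + Y / η) := by
    calc ∑ n ∈ range N, ((n : ℝ) + 1) ^ (-s.re)
        ≤ ∑ n ∈ range N, Y * ((n : ℝ) + 1)⁻¹ := by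
          refine sum_le_sum fun n hn ↦ ?_
          have hn' : (n : ℝ) + 1 ≤ N := by exact_mod_cast (mem_range.mp hn)
          have hn0 : (0 : ℝ) < (n : ℝ) + 1 := by positivity
          calc ((n : ℝ) + 1) ^ (-s.re) ≤ ((n : ℝ) + 1) ^ (η + -1) :=
                Real.rpow_le_rpow_of_exponent_le (by linarith [n.cast_nonneg (α := ℝ)])
                  (by linarith)
            _ = ((n : ℝ) + 1) ^ η * ((n : ℝ) + 1)⁻¹ := by
                rw [Real.rpow_add hn0, Real.rpow_neg_one]
            _ ≤ Y * ((n : ℝ) + 1)⁻¹ := by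
                gcongr
                exact Real.rpow_le_rpow hn0.le hn' hη0.le
      _ = Y * ((harmonic N : ℚ) : ℝ) := by
          rw [← mul_sum, harmonic]; push_cast; rfl
      _ ≤ Y * (1 + Y / η) := by
          gcongr
          refine (harmonic_le_one_add_log N).trans ?_
          gcongr
          exact Real.log_le_rpow_div hN0.le hη0
  have h2 : (N : ℝ) ^ (1 - s.re) ≤ Y := Real.rpow_le_rpow_of_exponent_le hN1 (by linarith)
  have h3 : ‖s‖ / s.re * (N : ℝ) ^ (-s.re) ≤ 8 * Y := by
    have hsn : ‖s‖ ≤ 4 * N := by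
      have := norm_le_abs_re_add_abs_im s
      rw [abs_of_pos (by linarith : 0 < s.re)] at this
      linarith
    have : (N : ℝ) ^ (-s.re) ≤ Y * (N : ℝ)⁻¹ := by
      rw [hY, ← Real.rpow_neg_one, ← Real.rpow_add hN0]
      exact Real.rpow_le_rpow_of_exponent_le hN1 (by linarith)
    calc ‖s‖ / s.re * (N : ℝ) ^ (-s.re) ≤ (4 * N) / (1 / 2) * (Y * (N : ℝ)⁻¹) := by gcongr
      _ = 8 * Y := by field_simp; norm_num
  have hYY : Y * Y ≤ 2 * T ^ ε := by
    rw [hY, ← Real.rpow_add hN0]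
    calc (N : ℝ) ^ (η + η) ≤ (2 * T) ^ ε := by
          rw [show η + η = ε by rw [hη]; ring]
          exact Real.rpow_le_rpow hN0.le hN2 hε.le
      _ = 2 ^ ε * T ^ ε := Real.mul_rpow (by norm_num) (by linarith)
      _ ≤ 2 ^ (1 : ℝ) * T ^ ε := by
          gcongr
          norm_num
      _ = 2 * T ^ ε := by norm_num
  have hinv : 0 < 1 / η := by positivity
  calc ‖riemannZeta s‖ ≤ Y * (1 + Y / η) + Y + 8 * Y := by
        refine (norm_riemannZeta_le_sum hN1' (by linarith) ht).trans ?_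
        gcongr
    _ = Y * 10 + Y * Y * (1 / η) := by ring
    _ ≤ Y * Y * 10 + Y * Y * (1 / η) := by
        gcongr
        nlinarith
    _ = (10 + 1 / η) * (Y * Y) := by ring
    _ ≤ (10 + 1 / η) * (2 * T ^ ε) := by gcongr
    _ = _ := by ring

/-- The consequence of `3 + 4 cos θ + cos 2θ ≥ 0` for the zeta function. -/
lemma one_le_norm_riemannZeta_product {x : ℝ} (hx : 0 < x) (y : ℝ) :
    1 ≤ ‖riemannZeta (1 + x)‖ ^ 3 * ‖riemannZeta (1 + x + I * y)‖ ^ 4 *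
      ‖riemannZeta (1 + x + 2 * I * y)‖ := by
  have h := DirichletCharacter.norm_LFunction_product_ge_one (1 : DirichletCharacter ℂ 1) hx y
  simpa [DirichletCharacter.LFunctionTrivChar, DirichletCharacter.LFunction_modOne_eq] using h

lemma exists_norm_riemannZeta_one_add_le :
    ∃ C : ℝ, 1 ≤ C ∧ ∀ x : ℝ, 0 < x → x ≤ 1 → ‖riemannZeta (1 + x)‖ ≤ C / x := by
  have hc : Continuous fun x : ℝ ↦ riemannZeta₁ (1 + x) :=
    differentiable_riemannZeta₁.continuous.comp (by fun_prop)
  obtain ⟨C, hC⟩ := (isCompact_Icc (a := (0 : ℝ)) (b := 1)).exists_bound_of_continuousOn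
    hc.continuousOn
  refine ⟨max C 1, le_max_right _ _, fun x hx hx1 ↦ ?_⟩
  have hx' : (x : ℂ) ≠ 0 := by exact_mod_cast hx.ne'
  rw [riemannZeta_eq_inv_sub_mul (by simpa using hx'), norm_mul]
  have := hC x ⟨hx.le, hx1⟩
  rw [add_sub_cancel_left, norm_inv, norm_real, Real.norm_of_nonneg hx.le, div_eq_inv_mul]
  gcongr
  exact this.trans (le_max_left _ _)

end ZetaBounds

/-! ### Lower bound for ζ and the zero-free region. -/

section ZeroFree

open Complex Filter Topology Finset

/-- Z = T^(1/128) is the unit for all later powers of the height, so that they become natural powers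
of Z. -/
lemma exists_norm_riemannZeta_le_pow :
    ∃ C : ℝ, 1 ≤ C ∧ ∀ T : ℝ, 1 ≤ T → ∀ s : ℂ, 63 / 64 ≤ s.re → s.re ≤ 3 → 1 ≤ |s.im| →
      |s.im| ≤ 4 * T → ‖riemannZeta s‖ ≤ C * (T ^ (1 / 128 : ℝ)) ^ 4 := by
  obtain ⟨C, hC, h⟩ := exists_norm_riemannZeta_le (ε := 1 / 32) (by norm_num) (by norm_num)
  refine ⟨C * 4, by linarith, fun T hT s h1 h2 h3 h4 ↦ ?_⟩
  refine (h (4 * T) (by linarith) s (by norm_num; linarith) h2 h3 h4).trans ?_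
  have h4 : (4 : ℝ) ^ (1 / 32 : ℝ) ≤ 4 := by
    simpa using Real.rpow_le_rpow_of_exponent_le (x := (4 : ℝ)) (by norm_num)
      (by norm_num : (1 / 32 : ℝ) ≤ 1)
  have h5 : T ^ (1 / 32 : ℝ) = (T ^ (1 / 128 : ℝ)) ^ 4 := by
    rw [← Real.rpow_natCast, ← Real.rpow_mul (by linarith)]
    norm_num
  rw [Real.mul_rpow (by norm_num) (by linarith), h5, mul_assoc]
  gcongr

lemma ne_one_of_one_le_abs_im {s : ℂ} (h : 1 ≤ |s.im|) : s ≠ 1 := by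
  rintro rfl; norm_num at h

lemma exists_norm_deriv_riemannZeta_le_pow :
    ∃ C : ℝ, 1 ≤ C ∧ ∀ T : ℝ, 1 ≤ T → ∀ s : ℂ, 127 / 128 ≤ s.re → s.re ≤ 2 → 2 ≤ |s.im| →
      |s.im| ≤ 3 * T → ‖deriv riemannZeta s‖ ≤ C * (T ^ (1 / 128 : ℝ)) ^ 4 := by
  obtain ⟨C, hC, h⟩ := exists_norm_riemannZeta_le_pow
  refine ⟨C * 128, by linarith, fun T hT s h1 h2 h3 h4 ↦ ?_⟩
  have hball : ∀ z ∈ Metric.closedBall s (1 / 128), 63 / 64 ≤ z.re ∧ z.re ≤ 3 ∧ 1 ≤ |z.im| ∧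
      |z.im| ≤ 4 * T := by
    intro z hz
    rw [mem_closedBall_iff_norm] at hz
    have hre := (abs_re_le_norm (z - s)).trans hz
    have him := (abs_im_le_norm (z - s)).trans hz
    rw [sub_re] at hre
    rw [sub_im] at him
    have a1 := abs_le.mp hre
    have a2 := (abs_abs_sub_abs_le z.im s.im).trans him
    have a3 := abs_le.mp a2
    refine ⟨?_, ?_, ?_, ?_⟩ <;> linarith [a1.1, a1.2, a3.1, a3.2]
  have := norm_deriv_le_of_forall_mem_sphere_norm_le (c := s) (R := 1 / 128)
    (C := C * (T ^ (1 / 128 : ℝ)) ^ 4) (f := riemannZeta) (by norm_num)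
    (DifferentiableOn.diffContOnCl_ball (U := {1}ᶜ) differentiableOn_riemannZeta
      fun z hz ↦ ne_one_of_one_le_abs_im (hball z hz).2.2.1)
    fun z hz ↦ by
      obtain ⟨b1, b2, b3, b4⟩ := hball z (Metric.sphere_subset_closedBall hz)
      exact h T hT z b1 b2 b3 b4
  refine this.trans (le_of_eq ?_)
  ring

/-- The 3-4-1 inequality solved for ζ(s): the simple pole costs (re s - 1)^(-3) and ζ(σ + 2it) costs
Z^4. Keeping fourth powers avoids roots. -/
lemma exists_le_norm_riemannZeta_one_add :
    ∃ κ : ℝ, 0 < κ ∧ ∀ T : ℝ, 1 ≤ T → ∀ s : ℂ, 1 < s.re → s.re ≤ 2 → 1 ≤ |s.im| →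
      |s.im| ≤ 2 * T → κ ^ 4 * (s.re - 1) ^ 3 ≤ (T ^ (1 / 128 : ℝ) * ‖riemannZeta s‖) ^ 4 := by
  obtain ⟨C, hC, h⟩ := exists_norm_riemannZeta_le_pow
  obtain ⟨A, hA, hA'⟩ := exists_norm_riemannZeta_one_add_le
  have hAC : 1 ≤ A ^ 3 * C := one_le_mul_of_one_le_of_one_le (one_le_pow₀ hA) hC
  refine ⟨(A ^ 3 * C)⁻¹, by positivity, fun T hT s h1 h2 h3 h4 ↦ ?_⟩
  set x := s.re - 1 with hx
  have hx0 : 0 < x := by linarith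
  set Z := T ^ (1 / 128 : ℝ) with hZ
  have key := one_le_norm_riemannZeta_product hx0 s.im
  have e1 : (1 + x + I * s.im : ℂ) = s := by
    apply Complex.ext <;> simp [hx]
  have e2 : ‖riemannZeta (1 + x + 2 * I * s.im)‖ ≤ C * Z ^ 4 := by
    apply h T hT
    · simp; linarith
    · simp; linarith
    · simp [abs_mul]; linarith
    · simp [abs_mul]; linarith
  rw [e1] at key
  have key2 : 1 ≤ (A / x) ^ 3 * ‖riemannZeta s‖ ^ 4 * (C * Z ^ 4) := by
    refine key.trans ?_
    have := hA' x hx0 (by linarith)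
    gcongr
  have key3 : x ^ 3 ≤ (A ^ 3 * C) * (Z * ‖riemannZeta s‖) ^ 4 := by
    have := mul_le_mul_of_nonneg_left key2 (pow_pos hx0 3).le
    calc x ^ 3 = x ^ 3 * 1 := by ring
      _ ≤ _ := this
      _ = _ := by field_simp
  have hinv : (A ^ 3 * C)⁻¹ ≤ 1 := inv_le_one_of_one_le₀ hAC
  calc (A ^ 3 * C)⁻¹ ^ 4 * x ^ 3 ≤ (A ^ 3 * C)⁻¹ * x ^ 3 := by
        gcongr
        exact pow_le_of_le_one (by positivity) hinv (by norm_num)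
    _ ≤ (A ^ 3 * C)⁻¹ * ((A ^ 3 * C) * (Z * ‖riemannZeta s‖) ^ 4) := by gcongr
    _ = _ := by field_simp

/-- A zero-free region, of width a small negative power of the height, together with a lower
bound for the zeta function there. -/
lemma exists_le_norm_riemannZeta :
    ∃ c : ℝ, 0 < c ∧ c ≤ 1 / 4 ∧ ∃ c' : ℝ, 0 < c' ∧ ∀ T : ℝ, 1 ≤ T → ∀ s : ℂ,
      1 - (c / (T ^ (1 / 128 : ℝ)) ^ 5) ^ 4 ≤ s.re → s.re ≤ 2 → 2 ≤ |s.im| → |s.im| ≤ 2 * T →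
        c' ≤ (T ^ (1 / 128 : ℝ)) ^ 16 * ‖riemannZeta s‖ := by
  obtain ⟨κ, hκ, hlow⟩ := exists_le_norm_riemannZeta_one_add
  obtain ⟨D, hD, hder⟩ := exists_norm_deriv_riemannZeta_le_pow
  -- With q = c / Z^5, the lower bound at re s = 1 + q^4 is κ c³ / Z^16, while moving left across
  -- the strip changes ζ by at most 2Dc⁴ / Z^16. The powers of Z agree, so c ≤ κ/(4D) loses at most
  -- half of the bound.
  set c := min (1 / 4) (κ / (4 * D)) with hc
  have hc0 : 0 < c := by positivity
  have hc1 : c ≤ 1 / 4 := min_le_left _ _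
  have hcD : c * (4 * D) ≤ κ := (le_div_iff₀ (by positivity)).mp (min_le_right _ _)
  refine ⟨c, hc0, hc1, κ * c ^ 3 / 2, by positivity, fun T hT s h1 h2 h3 h4 ↦ ?_⟩
  set Z := T ^ (1 / 128 : ℝ) with hZ
  have hZ1 : 1 ≤ Z := Real.one_le_rpow hT (by norm_num)
  have hZ0 : 0 < Z := by linarith
  set q := c / Z ^ 5 with hq
  have hq0 : 0 < q := by positivity
  have hqc : q ≤ 1 / 4 := by
    refine le_trans ?_ hc1
    rw [hq]
    exact div_le_self hc0.le (one_le_pow₀ hZ1)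
  have hδ : q ^ 4 ≤ 1 / 256 := by
    calc q ^ 4 ≤ (1 / 4) ^ 4 := by gcongr
      _ = _ := by norm_num
  have hright : ∀ z : ℂ, 1 + q ^ 4 ≤ z.re → z.re ≤ 2 → 2 ≤ |z.im| → |z.im| ≤ 2 * T →
      κ * q ^ 3 ≤ Z * ‖riemannZeta z‖ := by
    intro z z1 z2 z3 z4
    have hp : 0 < q ^ 4 := by positivity
    have := hlow T hT z (by linarith) z2 (by linarith) z4
    refine le_of_pow_le_pow_left₀ (n := 4) (by norm_num) (by positivity) (le_trans ?_ this)
    calc (κ * q ^ 3) ^ 4 = κ ^ 4 * (q ^ 4) ^ 3 := by ring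
      _ ≤ κ ^ 4 * (z.re - 1) ^ 3 := by
        gcongr
        linarith
  have hconv : ∀ w : ℝ, κ * q ^ 3 ≤ Z * w → κ * c ^ 3 ≤ Z ^ 16 * w := by
    intro w hw
    calc κ * c ^ 3 = Z ^ 15 * (κ * q ^ 3) := by rw [hq]; field_simp
      _ ≤ Z ^ 15 * (Z * w) := by gcongr
      _ = Z ^ 16 * w := by ring
  have hpos : 0 < κ * c ^ 3 := by positivity
  rcases le_or_gt (1 + q ^ 4) s.re with hs | hs
  · have := hconv _ (hright s hs h2 h3 h4)
    linarith
  · set z : ℂ := ⟨1 + q ^ 4, s.im⟩ with hz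
    have hzl := hconv _ (hright z le_rfl (by simp only [hz]; linarith) h3 h4)
    set S : Set ℂ := {w | 127 / 128 ≤ w.re} ∩ {w | w.re ≤ 2} ∩ {w | w.im = s.im} with hS
    have hSc : Convex ℝ S :=
      ((convex_halfSpace_re_ge _).inter (convex_halfSpace_re_le _)).inter
        (convex_hyperplane (IsLinearMap.mk Complex.add_im Complex.smul_im) _)
    have hmv := hSc.norm_image_sub_le_of_norm_deriv_le (f := riemannZeta) (C := D * Z ^ 4)
      (x := s) (y := z)
      (fun w hw ↦ differentiableAt_riemannZeta (ne_one_of_one_le_abs_im (by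
        have : w.im = s.im := hw.2
        rw [this]; linarith)))
      (fun w hw ↦ by
        have : w.im = s.im := hw.2
        exact hder T hT w hw.1.1 hw.1.2 (by rwa [this]) (by rw [this]; linarith))
      ⟨⟨show 127 / 128 ≤ s.re by linarith, h2⟩, rfl⟩
      ⟨⟨show 127 / 128 ≤ 1 + q ^ 4 by linarith [pow_pos hq0 4], show 1 + q ^ 4 ≤ 2 by linarith⟩, rfl⟩
    have hzs : ‖z - s‖ ≤ 2 * q ^ 4 := by
      have : z - s = ((1 + q ^ 4 - s.re : ℝ) : ℂ) := by
        apply Complex.ext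
        · simp only [sub_re, ofReal_re, hz]
        · simp only [sub_im, ofReal_im, hz, sub_self]
      rw [this, norm_real, Real.norm_of_nonneg (by linarith)]
      linarith
    have h5 : ‖riemannZeta z‖ ≤ ‖riemannZeta s‖ + D * Z ^ 4 * (2 * q ^ 4) := by
      have a1 := norm_le_norm_add_norm_sub' (riemannZeta z) (riemannZeta s)
      have a2 : ‖riemannZeta z - riemannZeta s‖ ≤ D * Z ^ 4 * (2 * q ^ 4) :=
        hmv.trans (by gcongr)
      linarith
    have h6 : Z ^ 16 * (D * Z ^ 4 * (2 * q ^ 4)) = 2 * D * c ^ 4 := by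
      rw [hq]; field_simp
    have h7 : 2 * D * c ^ 4 ≤ κ * c ^ 3 / 2 := by
      have : c ^ 3 * (c * (4 * D)) ≤ c ^ 3 * κ := by gcongr
      linarith
    have h8 : Z ^ 16 * ‖riemannZeta z‖ ≤ Z ^ 16 * ‖riemannZeta s‖ + 2 * D * c ^ 4 := by
      rw [← h6, ← mul_add]
      gcongr
    linarith

end ZeroFree

/-! ### The function -ζ'/ζ - ζ and its second derivative. -/

section LogDeriv

open Complex Filter Topology Finset

/-- The analytic continuation of `-ζ'/ζ - ζ`, the Dirichlet series with coefficients `Λ n - 1`. -/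
noncomputable def zetaLogDerivError (s : ℂ) : ℂ :=
  -(deriv riemannZeta₁ s / riemannZeta₁ s) - riemannZeta₀ s

lemma riemannZeta₁_ne_zero {s : ℂ} (h : s ≠ 1) (hs : riemannZeta s ≠ 0) : riemannZeta₁ s ≠ 0 := by
  rw [riemannZeta_eq_inv_sub_mul h] at hs
  exact right_ne_zero_of_mul hs

lemma riemannZeta₁_ne_zero_of_one_le_re {s : ℂ} (hs : 1 ≤ s.re) : riemannZeta₁ s ≠ 0 := by
  rcases eq_or_ne s 1 with rfl | h
  · simp
  · exact riemannZeta₁_ne_zero h (riemannZeta_ne_zero_of_one_le_re hs)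

lemma analyticAt_zetaLogDerivError {s : ℂ} (hs : riemannZeta₁ s ≠ 0) :
    AnalyticAt ℂ zetaLogDerivError s := by
  have h1 : AnalyticAt ℂ riemannZeta₁ s := differentiable_riemannZeta₁.analyticAt s
  have h0 : AnalyticAt ℂ riemannZeta₀ s := differentiable_riemannZeta₀.analyticAt s
  exact ((h1.deriv.div h1 hs).neg).sub h0

/-- The logarithmic derivative of (s - 1)ζ(s) and `riemannZeta₀` each omit a term 1/(s - 1); these
cancel, so no pole remains at 1. -/
lemma zetaLogDerivError_eq {s : ℂ} (h : s ≠ 1) (hs : riemannZeta s ≠ 0) :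
    zetaLogDerivError s = -(deriv riemannZeta s / riemannZeta s) - riemannZeta s := by
  have hs1 : s - 1 ≠ 0 := sub_ne_zero.mpr h
  have h1 := riemannZeta₁_ne_zero h hs
  have hz := riemannZeta_eq_inv_sub_mul h
  have hd : deriv riemannZeta₁ s = riemannZeta s + (s - 1) * deriv riemannZeta s := by
    have : riemannZeta₁ =ᶠ[𝓝 s] fun z ↦ (z - 1) * riemannZeta z := by
      filter_upwards [isOpen_ne.mem_nhds h] with z hz
      rw [riemannZeta_eq_inv_sub_mul hz, mul_inv_cancel_left₀ (sub_ne_zero.mpr hz)]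
    rw [this.deriv_eq]
    have := ((hasDerivAt_id s).sub_const 1).mul (differentiableAt_riemannZeta h).hasDerivAt
    exact this.deriv.trans (by simp)
  have h1e : riemannZeta₁ s = (s - 1) * riemannZeta s := by
    rw [hz, mul_inv_cancel_left₀ hs1]
  have h0 : riemannZeta₀ s = riemannZeta s - (s - 1)⁻¹ := by
    rw [riemannZeta_eq_inv_sub_add h]; ring
  rw [zetaLogDerivError, hd, h1e, h0]
  field_simp
  ring

lemma exists_norm_zetaLogDerivError_le :
    ∃ c : ℝ, 0 < c ∧ c ≤ 1 / 4 ∧ ∃ C : ℝ, 0 < C ∧ ∀ T : ℝ, 1 ≤ T → ∀ s : ℂ,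
      1 - (c / (T ^ (1 / 128 : ℝ)) ^ 5) ^ 4 ≤ s.re → s.re ≤ 2 → 2 ≤ |s.im| → |s.im| ≤ 2 * T →
        riemannZeta s ≠ 0 ∧ ‖zetaLogDerivError s‖ ≤ C * (T ^ (1 / 128 : ℝ)) ^ 20 := by
  obtain ⟨c, hc0, hc1, c', hc', hlow⟩ := exists_le_norm_riemannZeta
  obtain ⟨D, hD, hder⟩ := exists_norm_deriv_riemannZeta_le_pow
  obtain ⟨A, hA, hup⟩ := exists_norm_riemannZeta_le_pow
  refine ⟨c, hc0, hc1, D / c' + A, by positivity, fun T hT s h1 h2 h3 h4 ↦ ?_⟩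
  have hl := hlow T hT s h1 h2 h3 h4
  set Z := T ^ (1 / 128 : ℝ) with hZ
  have hZ1 : 1 ≤ Z := Real.one_le_rpow hT (by norm_num)
  have hZ0 : 0 < Z := by linarith
  have hδ : (c / Z ^ 5) ^ 4 ≤ 1 / 256 := by
    calc (c / Z ^ 5) ^ 4 ≤ (1 / 4) ^ 4 := by
          have := (div_le_self hc0.le (one_le_pow₀ hZ1 (n := 5))).trans hc1
          gcongr
      _ = _ := by norm_num
  have hd := hder T hT s (by linarith) h2 h3 (by linarith)
  have hu := hup T hT s (by linarith) (by linarith) (by linarith) (by linarith)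
  have hne : riemannZeta s ≠ 0 := by
    intro h0
    rw [h0, norm_zero, mul_zero] at hl
    linarith
  refine ⟨hne, ?_⟩
  have hpos : 0 < ‖riemannZeta s‖ := norm_pos_iff.mpr hne
  have hinv : ‖riemannZeta s‖⁻¹ ≤ Z ^ 16 / c' := by
    rw [inv_le_iff_one_le_mul₀ hpos, div_mul_eq_mul_div, one_le_div hc']
    exact hl
  rw [zetaLogDerivError_eq (ne_one_of_one_le_abs_im (by linarith)) hne]
  calc _ ≤ ‖deriv riemannZeta s‖ * ‖riemannZeta s‖⁻¹ + ‖riemannZeta s‖ := by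
        refine (norm_sub_le _ _).trans ?_
        rw [norm_neg, norm_div, div_eq_mul_inv]
    _ ≤ D * Z ^ 4 * (Z ^ 16 / c') + A * Z ^ 20 := by
        gcongr
        refine hu.trans ?_
        gcongr
        norm_num
    _ = _ := by ring

/-- The second derivative of `-ζ'/ζ - ζ` grows slower than linearly along vertical lines,
uniformly up to the line `re s = 1`. -/
lemma exists_norm_iteratedDeriv_zetaLogDerivError_le :
    ∃ C : ℝ, 0 < C ∧ ∀ s : ℂ, 1 ≤ s.re → s.re ≤ 3 / 2 →
      ‖iteratedDeriv 2 zetaLogDerivError s‖ ≤ C * (1 + |s.im|) ^ (1 / 2 : ℝ) := by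
  obtain ⟨c, hc0, hc1, C, hC, h⟩ := exists_norm_zetaLogDerivError_le
  obtain ⟨K, hK⟩ : ∃ K : ℝ, ∀ s ∈ Set.Icc (1 : ℝ) (3 / 2) ×ℂ Set.Icc (-3 : ℝ) 3,
      ‖iteratedDeriv 2 zetaLogDerivError s‖ ≤ K := by
    refine (IsCompact.reProdIm isCompact_Icc isCompact_Icc).exists_bound_of_continuousOn ?_
    intro s hs
    have := analyticAt_zetaLogDerivError (riemannZeta₁_ne_zero_of_one_le_re hs.1.1)
    rw [iteratedDeriv_eq_iterate]
    exact (this.deriv.deriv).continuousAt.continuousWithinAt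
  refine ⟨max K (2 * C / c ^ 8), lt_max_of_lt_right (by positivity), fun s h1 h2 ↦ ?_⟩
  rcases le_or_gt |s.im| 3 with h3 | h3
  · have h4 : 1 ≤ (1 + |s.im|) ^ (1 / 2 : ℝ) :=
      Real.one_le_rpow (by linarith [abs_nonneg s.im]) (by norm_num)
    calc _ ≤ K := hK s ⟨⟨h1, h2⟩, abs_le.mp h3⟩
      _ ≤ max K (2 * C / c ^ 8) * 1 := by rw [mul_one]; exact le_max_left _ _
      _ ≤ _ := by
        gcongr
  · set T := |s.im| with hT
    set Z := T ^ (1 / 128 : ℝ) with hZ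
    have hT1 : 1 ≤ T := by linarith
    have hZ1 : 1 ≤ Z := Real.one_le_rpow hT1 (by norm_num)
    have hZ0 : 0 < Z := by linarith
    set R := (c / Z ^ 5) ^ 4 with hR
    have hR0 : 0 < R := by positivity
    have hδ : R ≤ 1 / 256 := by
      calc (c / Z ^ 5) ^ 4 ≤ (1 / 4) ^ 4 := by
            have := (div_le_self hc0.le (one_le_pow₀ hZ1 (n := 5))).trans hc1
            gcongr
        _ = _ := by norm_num
    have hball : ∀ z ∈ Metric.closedBall s R, 1 - R ≤ z.re ∧ z.re ≤ 2 ∧ 2 ≤ |z.im| ∧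
        |z.im| ≤ 2 * T := by
      intro z hz
      rw [mem_closedBall_iff_norm] at hz
      have hre := (abs_re_le_norm (z - s)).trans hz
      have him := (abs_im_le_norm (z - s)).trans hz
      rw [sub_re] at hre
      rw [sub_im] at him
      have a1 := abs_le.mp hre
      have a3 := abs_le.mp ((abs_abs_sub_abs_le z.im s.im).trans him)
      refine ⟨?_, ?_, ?_, ?_⟩ <;> linarith [a1.1, a1.2, a3.1, a3.2]
    have hcau := norm_iteratedDeriv_le_of_forall_mem_sphere_norm_le (c := s) (R := R)
      (C := C * Z ^ 20) (f := zetaLogDerivError) 2 hR0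
      (DifferentiableOn.diffContOnCl_ball (U := Metric.closedBall s R)
        (fun z hz ↦ by
          obtain ⟨b1, b2, b3, b4⟩ := hball z hz
          exact (analyticAt_zetaLogDerivError (riemannZeta₁_ne_zero
            (ne_one_of_one_le_abs_im (by linarith))
            (h T hT1 z b1 b2 b3 b4).1)).differentiableAt.differentiableWithinAt) subset_rfl)
      fun z hz ↦ by
        obtain ⟨b1, b2, b3, b4⟩ := hball z (Metric.sphere_subset_closedBall hz)
        exact (h T hT1 z b1 b2 b3 b4).2
    -- Z^20 bounds the function and Cauchy's estimate with radius R, of order Z^(-20), costs Z^40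
    -- for two derivatives. The unit T^(1/128) is small enough that 60/128 ≤ 1/2.
    have hZ60 : Z ^ 60 ≤ (1 + T) ^ (1 / 2 : ℝ) := by
      calc Z ^ 60 = T ^ (60 / 128 : ℝ) := by
            rw [hZ, ← Real.rpow_natCast, ← Real.rpow_mul (by linarith)]
            norm_num
        _ ≤ T ^ (1 / 2 : ℝ) := Real.rpow_le_rpow_of_exponent_le hT1 (by norm_num)
        _ ≤ _ := Real.rpow_le_rpow (by linarith) (by linarith) (by norm_num)
    calc _ ≤ _ := hcau
      _ = 2 * C / c ^ 8 * Z ^ 60 := by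
        rw [hR]
        simp only [Nat.factorial]
        push_cast
        field_simp
      _ ≤ max K (2 * C / c ^ 8) * (1 + T) ^ (1 / 2 : ℝ) := by
        have : 0 < 2 * C / c ^ 8 := by positivity
        have := le_max_right K (2 * C / c ^ 8)
        gcongr

end LogDeriv

/-! ### Smoothed Perron formula for the coefficients (Λ(n) - 1)(log n)². -/

section Perron

open Complex Filter Topology Finset MeasureTheory ArithmeticFunction

lemma abscissaOfAbsConv_vonMangoldt_sub_one_le :
    LSeries.abscissaOfAbsConv ((fun n ↦ (vonMangoldt n : ℂ)) - 1) ≤ 1 := by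
  refine LSeries.abscissaOfAbsConv_le_of_forall_lt_LSeriesSummable (x := 1) fun y hy ↦ ?_
  exact (LSeriesSummable_vonMangoldt (by simpa using hy)).sub
    (LSeriesSummable_one_iff.mpr (by simpa using hy))

lemma LSeries_vonMangoldt_sub_one {s : ℂ} (hs : 1 < s.re) :
    LSeries ((fun n ↦ (vonMangoldt n : ℂ)) - 1) s = zetaLogDerivError s := by
  have h1 : s ≠ 1 := by rintro rfl; simp at hs
  rw [LSeries_sub (LSeriesSummable_vonMangoldt hs) (LSeriesSummable_one_iff.mpr hs),
    LSeries_vonMangoldt_eq_deriv_riemannZeta_div hs, LSeries_one_eq_riemannZeta hs,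
    zetaLogDerivError_eq h1 (riemannZeta_ne_zero_of_one_lt_re hs), neg_div]

/-- The coefficients `(Λ n - 1) (log n)²`. -/
noncomputable def mangoldtErrorCoeff (n : ℕ) : ℝ := (vonMangoldt n - 1) * Real.log n ^ 2

lemma logMul_vonMangoldt_sub_one :
    LSeries.logMul^[2] ((fun n ↦ (vonMangoldt n : ℂ)) - 1) =
      fun n ↦ (mangoldtErrorCoeff n : ℂ) := by
  ext n
  simp only [Function.iterate_succ, Function.iterate_zero, Function.comp_apply, id,
    LSeries.logMul, mangoldtErrorCoeff, Pi.sub_apply, Pi.one_apply]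
  rw [← natCast_log]
  push_cast
  ring

lemma LSeriesSummable_mangoldtErrorCoeff {s : ℂ} (hs : 1 < s.re) :
    LSeriesSummable (fun n ↦ (mangoldtErrorCoeff n : ℂ)) s := by
  rw [← logMul_vonMangoldt_sub_one]
  refine LSeriesSummable_of_abscissaOfAbsConv_lt_re ?_
  rw [LSeries.absicssaOfAbsConv_logPowMul]
  exact abscissaOfAbsConv_vonMangoldt_sub_one_le.trans_lt (by exact_mod_cast hs)

lemma LSeries_mangoldtErrorCoeff {s : ℂ} (hs : 1 < s.re) :
    LSeries (fun n ↦ (mangoldtErrorCoeff n : ℂ)) s = iteratedDeriv 2 zetaLogDerivError s := by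
  have h := LSeries_iteratedDeriv (f := (fun n ↦ (vonMangoldt n : ℂ)) - 1) 2 (s := s)
    (abscissaOfAbsConv_vonMangoldt_sub_one_le.trans_lt (by exact_mod_cast hs))
  rw [logMul_vonMangoldt_sub_one] at h
  rw [← one_mul (LSeries _ s), show (1 : ℂ) = (-1) ^ 2 by norm_num, ← h]
  refine Filter.EventuallyEq.iteratedDeriv_eq 2 ?_
  filter_upwards [(isOpen_lt continuous_const continuous_re).mem_nhds hs] with z hz
  exact LSeries_vonMangoldt_sub_one hz

/-- The continuous weight max(1 - x, 0) has a quadratically decaying transform, which makes the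
Perron integral absolutely convergent. -/
lemma hasMellin_max_one_sub {s : ℂ} (hs : 0 < s.re) :
    HasMellin (fun x : ℝ ↦ ((max (1 - x) 0 : ℝ) : ℂ)) s (1 / (s * (s + 1))) := by
  have h1 := hasMellin_one_Ioc hs
  have h2 := hasMellin_cpow_Ioc 1 (s := s) (by simp; linarith)
  have h := hasMellin_sub h1.1 h2.1
  rw [h1.2, h2.2] at h
  have hs0 : s ≠ 0 := by rintro rfl; simp at hs
  have hs1 : s + 1 ≠ 0 := by
    intro h0
    have := congrArg re h0
    simp at this
    linarith
  have he : (1 / s - 1 / (s + 1) : ℂ) = 1 / (s * (s + 1)) := by field_simp; ring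
  rw [he] at h
  have hcongr : ∀ x ∈ Set.Ioi (0 : ℝ), ((max (1 - x) 0 : ℝ) : ℂ) =
      (Set.Ioc 0 1).indicator (fun _ ↦ (1 : ℂ)) x -
        (Set.Ioc 0 1).indicator (fun t : ℝ ↦ (t : ℂ) ^ (1 : ℂ)) x := by
    intro x hx
    rcases le_or_gt x 1 with h1 | h1
    · rw [Set.indicator_of_mem (Set.mem_Ioc.mpr ⟨hx, h1⟩),
        Set.indicator_of_mem (Set.mem_Ioc.mpr ⟨hx, h1⟩),
        max_eq_left (by linarith)]
      simp
    · rw [Set.indicator_of_notMem (by simp [h1]), Set.indicator_of_notMem (by simp [h1]),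
        max_eq_right (by linarith)]
      simp
  constructor
  · refine h.1.congr_fun (fun x hx ↦ ?_) measurableSet_Ioi
    simp only [hcongr x hx]
  · rw [← h.2]
    refine setIntegral_congr_fun measurableSet_Ioi fun x hx ↦ ?_
    simp only [hcongr x hx]

lemma add_mul_I_norm_bound {σ : ℝ} (hσ : 1 ≤ σ) (t : ℝ) :
    ‖1 / (((σ : ℂ) + t * I) * ((σ : ℂ) + t * I + 1))‖ ≤ 2 * (1 + |t|) ^ (-2 : ℝ) := by
  have h1 : (1 + |t|) ^ 2 / 2 ≤ ‖((σ : ℂ) + t * I)‖ ^ 2 := by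
    rw [← normSq_eq_norm_sq, normSq_add_mul_I]
    nlinarith [sq_abs t, sq_nonneg (|t| - 1), abs_nonneg t]
  have h2 : ‖((σ : ℂ) + t * I)‖ ≤ ‖((σ : ℂ) + t * I + 1)‖ := by
    rw [show (σ : ℂ) + t * I + 1 = ((σ + 1 : ℝ) : ℂ) + t * I by push_cast; ring,
      norm_add_mul_I, norm_add_mul_I]
    apply Real.sqrt_le_sqrt
    nlinarith
  have h3 : (1 + |t|) ^ 2 / 2 ≤ ‖((σ : ℂ) + t * I)‖ * ‖((σ : ℂ) + t * I + 1)‖ := by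
    refine h1.trans ?_
    rw [sq]
    gcongr
  have h4 : 0 < (1 + |t|) ^ 2 / 2 := by positivity
  rw [norm_div, norm_one, norm_mul, Real.rpow_neg (by positivity)]
  calc _ ≤ 1 / ((1 + |t|) ^ 2 / 2) := by gcongr
    _ = _ := by
      norm_cast
      field_simp

lemma integrable_inv_mul_add_one {σ : ℝ} (hσ : 1 ≤ σ) :
    Integrable fun t : ℝ ↦ 1 / (((σ : ℂ) + t * I) * ((σ : ℂ) + t * I + 1)) := by
  have h := (integrable_one_add_norm (E := ℝ) (μ := volume) (r := 2) (by simp)).const_mul 2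
  refine h.mono' ?_ (ae_of_all _ fun t ↦ add_mul_I_norm_bound hσ t)
  have h0 : ∀ t : ℝ, ((σ : ℂ) + t * I) * ((σ : ℂ) + t * I + 1) ≠ 0 := by
    intro t h0
    rcases mul_eq_zero.mp h0 with h | h <;>
    · have := congrArg re h
      simp at this
      linarith
  exact (Continuous.div continuous_const (by fun_prop) h0).aestronglyMeasurable

lemma integral_cpow_div_mul_add_one {σ x : ℝ} (hσ : 1 ≤ σ) (hx : 0 < x) :
    ∫ t : ℝ, (x : ℂ) ^ (-((σ : ℂ) + t * I)) * (1 / (((σ : ℂ) + t * I) * ((σ : ℂ) + t * I + 1)))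
      = 2 * Real.pi * ((max (1 - x) 0 : ℝ) : ℂ) := by
  have hm : ∀ t : ℝ, mellin (fun x : ℝ ↦ ((max (1 - x) 0 : ℝ) : ℂ)) ((σ : ℂ) + t * I) =
      1 / (((σ : ℂ) + t * I) * ((σ : ℂ) + t * I + 1)) := fun t ↦
    (hasMellin_max_one_sub (by simp; linarith)).2
  have h := mellinInv_mellin_eq σ (fun x : ℝ ↦ ((max (1 - x) 0 : ℝ) : ℂ)) hx
    (hasMellin_max_one_sub (by simp; linarith)).1
    (by
      unfold VerticalIntegrable
      simp_rw [hm]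
      exact integrable_inv_mul_add_one hσ)
    (by fun_prop)
  rw [mellinInv] at h
  simp_rw [hm] at h
  simp only [smul_eq_mul] at h
  rw [← h, real_smul]
  push_cast
  rw [← mul_assoc, mul_one_div_cancel (by simp [Real.pi_ne_zero]), one_mul]

lemma tsum_mangoldtErrorCoeff_eq {σ X : ℝ} (hσ : 1 < σ) (hX : 0 < X) :
    ∑' n : ℕ, (mangoldtErrorCoeff n : ℂ) * (2 * Real.pi * ((max (1 - n / X) 0 : ℝ) : ℂ)) =
      ∫ t : ℝ, iteratedDeriv 2 zetaLogDerivError ((σ : ℂ) + t * I) *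
        ((X : ℂ) ^ ((σ : ℂ) + t * I) *
          (1 / (((σ : ℂ) + t * I) * ((σ : ℂ) + t * I + 1)))) := by
  set k : ℝ → ℂ := fun t ↦ 1 / (((σ : ℂ) + t * I) * ((σ : ℂ) + t * I + 1)) with hk
  set b : ℕ → ℂ := fun n ↦ (mangoldtErrorCoeff n : ℂ) with hb
  have hb0 : b 0 = 0 := by simp [hb, mangoldtErrorCoeff]
  have hX0 : (X : ℂ) ≠ 0 := by exact_mod_cast hX.ne'
  set F : ℕ → ℝ → ℂ := fun n t ↦ LSeries.term b ((σ : ℂ) + t * I) n *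
    ((X : ℂ) ^ ((σ : ℂ) + t * I) * k t) with hF
  have hki : Integrable k := integrable_inv_mul_add_one hσ.le
  have hFeq : ∀ n : ℕ, n ≠ 0 → ∀ t : ℝ, F n t =
      b n * (((n / X : ℝ) : ℂ) ^ (-((σ : ℂ) + t * I)) * k t) := by
    intro n hn t
    have hn' : (n : ℝ) ≠ 0 := by exact_mod_cast hn
    simp only [hF]
    rw [LSeries.term_of_ne_zero hn]
    have : ((n / X : ℝ) : ℂ) ^ (-((σ : ℂ) + t * I)) =
        (X : ℂ) ^ ((σ : ℂ) + t * I) / (n : ℂ) ^ ((σ : ℂ) + t * I) := by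
      have h := mul_cpow_ofReal_nonneg (a := n / X) (b := X) (by positivity) hX.le
        ((σ : ℂ) + t * I)
      rw [← ofReal_mul, div_mul_cancel₀ _ hX.ne', ofReal_natCast] at h
      have hXs : (X : ℂ) ^ ((σ : ℂ) + t * I) ≠ 0 := by simp [cpow_eq_zero_iff, hX0]
      rw [cpow_neg, h, div_mul_cancel_right₀ hXs]
    rw [this]
    ring
  have hnorm : ∀ n t, ‖F n t‖ = ‖LSeries.term b σ n‖ * X ^ σ * ‖k t‖ := by
    intro n t
    simp only [hF, norm_mul]
    rw [norm_cpow_eq_rpow_re_of_pos hX, LSeries.norm_term_eq, LSeries.norm_term_eq]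
    simp [mul_assoc]
  have hFi : ∀ n, Integrable (F n) := by
    intro n
    have hcont : Continuous fun t : ℝ ↦ LSeries.term b ((σ : ℂ) + t * I) n *
        (X : ℂ) ^ ((σ : ℂ) + t * I) := by
      rcases eq_or_ne n 0 with rfl | hn
      · simpa using continuous_const
      · simp only [LSeries.term_of_ne_zero hn]
        have hn' : (n : ℂ) ≠ 0 := by exact_mod_cast hn
        have h1 : Continuous fun t : ℝ ↦ (n : ℂ) ^ ((σ : ℂ) + t * I) :=
          Continuous.const_cpow (by fun_prop) (Or.inl hn')
        have h2 : Continuous fun t : ℝ ↦ (X : ℂ) ^ ((σ : ℂ) + t * I) :=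
          Continuous.const_cpow (by fun_prop) (Or.inl hX0)
        exact (continuous_const.div h1 fun t ↦ by simp [cpow_eq_zero_iff, hn]).mul h2
    have hmeas : AEStronglyMeasurable (F n) volume := by
      have := hcont.aestronglyMeasurable (μ := volume).mul hki.aestronglyMeasurable
      refine this.congr (ae_of_all _ fun t ↦ ?_)
      simp only [hF, Pi.mul_apply]
      ring
    refine (hki.norm.const_mul (‖LSeries.term b σ n‖ * X ^ σ)).mono' hmeas
      (ae_of_all _ fun t ↦ (hnorm n t).le)
  have hsum : Summable fun n ↦ ∫ t, ‖F n t‖ := by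
    simp_rw [hnorm, integral_const_mul]
    have : Summable fun n ↦ ‖LSeries.term b σ n‖ :=
      (LSeriesSummable_mangoldtErrorCoeff (s := σ) (by simpa using hσ)).norm
    exact (this.mul_right _).mul_right _
  have key := (hasSum_integral_of_summable_integral_norm hFi hsum).tsum_eq
  have hint : ∀ n, ∫ t, F n t = b n * (2 * Real.pi * ((max (1 - n / X) 0 : ℝ) : ℂ)) := by
    intro n
    rcases eq_or_ne n 0 with rfl | hn
    · simp [hF, hb0]
    · simp_rw [hFeq n hn, integral_const_mul]
      rw [integral_cpow_div_mul_add_one hσ.le (by positivity)]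
  simp_rw [hint] at key
  rw [key]
  refine integral_congr_ae (ae_of_all _ fun t ↦ ?_)
  simp only [hF]
  rw [tsum_mul_right]
  congr 1
  exact LSeries_mangoldtErrorCoeff (by simpa using hσ)

lemma exists_abs_sum_mangoldtErrorCoeff_le :
    ∃ K : ℝ, 0 < K ∧ ∀ X : ℝ, Real.exp 2 ≤ X →
      |∑ n ∈ range (⌊X⌋₊ + 1), mangoldtErrorCoeff n * (X - n)| ≤ K * X ^ 2 := by
  obtain ⟨C, hC, hbound⟩ := exists_norm_iteratedDeriv_zetaLogDerivError_le
  set J := ∫ t : ℝ, 2 * C * (1 + ‖t‖) ^ (-(3 / 2) : ℝ) with hJ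
  have hJi : Integrable fun t : ℝ ↦ 2 * C * (1 + ‖t‖) ^ (-(3 / 2) : ℝ) :=
    (integrable_one_add_norm (E := ℝ) (μ := volume) (r := 3 / 2) (by norm_num)).const_mul _
  have hJ0 : 0 ≤ J := integral_nonneg fun t ↦ by positivity
  refine ⟨Real.exp 1 * (J + 1), by positivity, fun X hX ↦ ?_⟩
  have hX0 : 0 < X := (Real.exp_pos 2).trans_le hX
  have hlog : 2 ≤ Real.log X := (Real.le_log_iff_exp_le hX0).mpr hX
  -- No contour is shifted: the derivative bound is uniform up to re s = 1, and this σ gives X^σ =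
  -- eX. The hypothesis e² ≤ X ensures σ ≤ 3/2. Growth of order 1/2 against decay of order 2 leaves
  -- the integrable exponent -3/2.
  set σ := 1 + 1 / Real.log X with hσ
  have hl0 : 0 < 1 / Real.log X := by positivity
  have hl1 : 1 / Real.log X ≤ 1 / 2 := by gcongr
  have hXσ : X ^ σ = Real.exp 1 * X := by
    rw [hσ, Real.rpow_add hX0, Real.rpow_one, Real.rpow_def_of_pos hX0, mul_one_div,
      div_self (by linarith)]
    ring
  have key := tsum_mangoldtErrorCoeff_eq (σ := σ) (by linarith) hX0
  have hle : ‖∫ t : ℝ, iteratedDeriv 2 zetaLogDerivError ((σ : ℂ) + t * I) *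
        ((X : ℂ) ^ ((σ : ℂ) + t * I) *
          (1 / (((σ : ℂ) + t * I) * ((σ : ℂ) + t * I + 1))))‖ ≤ X ^ σ * J := by
    rw [hJ, ← integral_const_mul]
    refine norm_integral_le_of_norm_le (hJi.const_mul _) (ae_of_all _ fun t ↦ ?_)
    rw [norm_mul, norm_mul, norm_cpow_eq_rpow_re_of_pos hX0]
    have h1 := hbound ((σ : ℂ) + t * I) (by simp; linarith) (by simp; linarith)
    have h2 := add_mul_I_norm_bound (σ := σ) (by linarith) t
    have h3 : ((σ : ℂ) + t * I).im = t := by simp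
    have h4 : ((σ : ℂ) + t * I).re = σ := by simp
    rw [h3] at h1
    rw [h4]
    have h5 : (1 + |t|) ^ (1 / 2 : ℝ) * (1 + |t|) ^ (-2 : ℝ) = (1 + |t|) ^ (-(3 / 2) : ℝ) := by
      rw [← Real.rpow_add (by positivity)]
      norm_num
    calc _ ≤ C * (1 + |t|) ^ (1 / 2 : ℝ) * (X ^ σ * (2 * (1 + |t|) ^ (-2 : ℝ))) := by gcongr
      _ = X ^ σ * (2 * C * ((1 + |t|) ^ (1 / 2 : ℝ) * (1 + |t|) ^ (-2 : ℝ))) := by ring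
      _ = _ := by rw [h5, Real.norm_eq_abs]
  rw [← key, tsum_eq_sum (s := range (⌊X⌋₊ + 1))] at hle
  · have hre : ∑ n ∈ range (⌊X⌋₊ + 1),
        (mangoldtErrorCoeff n : ℂ) * (2 * Real.pi * ((max (1 - n / X) 0 : ℝ) : ℂ)) =
        ((2 * Real.pi / X * ∑ n ∈ range (⌊X⌋₊ + 1), mangoldtErrorCoeff n * (X - n) : ℝ) : ℂ) := by
      rw [mul_sum]
      push_cast
      refine sum_congr rfl fun n hn ↦ ?_
      have hn' : (n : ℝ) ≤ X :=
        (Nat.le_floor_iff hX0.le).mp (Nat.lt_succ_iff.mp (mem_range.mp hn))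
      have : max (1 - n / X) 0 = (X - n) / X := by
        rw [max_eq_left]
        · field_simp
        · rw [sub_nonneg, div_le_one hX0]; exact hn'
      have h0 : ((max (1 - n / X) 0 : ℝ) : ℂ) = ((X : ℂ) - n) / X := by
        rw [this]; push_cast; ring
      rw [h0]
      ring
    rw [hre, norm_real, Real.norm_eq_abs, abs_mul, abs_of_pos (by positivity), hXσ] at hle
    have h6 : |∑ n ∈ range (⌊X⌋₊ + 1), mangoldtErrorCoeff n * (X - n)| ≤
        X / (2 * Real.pi) * (Real.exp 1 * X * J) := by
      rw [div_mul_eq_mul_div, div_le_iff₀ hX0] at hle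
      rw [div_mul_eq_mul_div, le_div_iff₀ (by positivity)]
      linarith
    have hpi : 1 ≤ 2 * Real.pi := by linarith [Real.pi_gt_three]
    calc _ ≤ _ := h6
      _ ≤ X / 1 * (Real.exp 1 * X * J) := by gcongr
      _ ≤ X / 1 * (Real.exp 1 * X * (J + 1)) := by gcongr; linarith
      _ = _ := by ring
  · intro n hn
    have hn' : X < n := by
      by_contra! h
      exact hn (mem_range.mpr (Nat.lt_succ_iff.mpr (Nat.le_floor h)))
    have : 1 - (n : ℝ) / X ≤ 0 := by
      rw [sub_nonpos, one_le_div hX0]; exact hn'.le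
    rw [max_eq_right this]
    simp

end Perron

/-! ### From smoothed sums to lower bounds for ψ and θ. -/

section PsiBound

open Finset ArithmeticFunction

/-- The summation range no longer depends on Y, so smoothed sums at two points can be subtracted
termwise. -/
lemma sum_mul_sub_eq_sum_mul_max (a : ℕ → ℝ) {Y : ℝ} (hY : 0 ≤ Y) {N : ℕ} (hN : ⌊Y⌋₊ + 1 ≤ N) :
    ∑ n ∈ range (⌊Y⌋₊ + 1), a n * (Y - n) = ∑ n ∈ range N, a n * max (Y - n) 0 := by
  rw [← sum_subset (range_subset_range.mpr hN)]
  · refine sum_congr rfl fun n hn ↦ ?_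
    have : (n : ℝ) ≤ Y := (Nat.le_floor_iff hY).mp (Nat.lt_succ_iff.mp (mem_range.mp hn))
    rw [max_eq_left (by linarith)]
  · intro n _ hn
    have : Y < n := by
      by_contra! h
      exact hn (mem_range.mpr (Nat.lt_succ_iff.mpr (Nat.le_floor h)))
    rw [max_eq_right (by linarith), mul_zero]

/-- From (log n - l)² ≥ 0, the square is at least 2l log n - l², so Stirling's bound for log M!
suffices. -/
lemma le_sum_log_sq {M : ℕ} (hM : M ≠ 0) (l : ℝ) (hl : 0 ≤ l) :
    2 * l * (M * Real.log M - M) - M * l ^ 2 ≤ ∑ n ∈ range (M + 1), Real.log n ^ 2 := by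
  have hst : M * Real.log M - M ≤ Real.log (M.factorial) := by
    have h1 := Stirling.le_log_factorial_stirling hM
    have h2 : 0 ≤ Real.log M := Real.log_natCast_nonneg M
    have h3 : 0 ≤ Real.log (2 * Real.pi) := Real.log_nonneg (by linarith [Real.pi_gt_three])
    linarith
  have hfac : Real.log (M.factorial) = ∑ n ∈ range M, Real.log ((n + 1 : ℕ) : ℝ) := by
    rw [← prod_range_add_one_eq_factorial]
    push_cast
    rw [Real.log_prod fun n _ ↦ by positivity]
  rw [sum_range_succ']
  calc 2 * l * (M * Real.log M - M) - M * l ^ 2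
      ≤ 2 * l * Real.log (M.factorial) - M * l ^ 2 := by gcongr
    _ = ∑ n ∈ range M, (2 * l * Real.log ((n + 1 : ℕ) : ℝ) - l ^ 2) := by
      rw [sum_sub_distrib, ← mul_sum, hfac]
      simp
    _ ≤ ∑ n ∈ range M, Real.log ((n + 1 : ℕ) : ℝ) ^ 2 :=
      sum_le_sum fun n _ ↦ by nlinarith [sq_nonneg (Real.log ((n + 1 : ℕ) : ℝ) - l)]
    _ ≤ _ := by simp

lemma psi_eq_sum_range (x : ℝ) : Chebyshev.psi x = ∑ n ∈ range (⌊x⌋₊ + 1), vonMangoldt n := by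
  rw [Chebyshev.psi_eq_sum_Icc, Nat.range_succ_eq_Icc_zero]

/-- The prime number theorem with error term `O(x / log x)` (lower bound). -/
lemma exists_sub_le_psi :
    ∃ C : ℝ, 0 < C ∧ ∀ x : ℝ, Real.exp 4 ≤ x → x - C * x / Real.log x ≤ Chebyshev.psi x := by
  obtain ⟨K, hK, hsum⟩ := exists_abs_sum_mangoldtErrorCoeff_le
  refine ⟨4 + 2 * Real.log 4 + 2 * K, by positivity, fun x hx ↦ ?_⟩
  have hx0 : 0 < x := (Real.exp_pos 4).trans_le hx
  set l := Real.log x with hl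
  have hl4 : 4 ≤ l := (Real.le_log_iff_exp_le hx0).mpr hx
  have he4 : Real.exp 4 = Real.exp 2 * Real.exp 2 := by rw [← Real.exp_add]; norm_num
  have he2 : 3 ≤ Real.exp 2 := by linarith [Real.add_one_le_exp (2 : ℝ)]
  -- The sums at x and x - h are subtracted and divided by h l². The analytic error 2Kx² becomes 2Kh
  -- because x = hl, the same order as the loss from shortening the interval by h.
  set h := x / l with hh
  have hlx : l ≤ x := (Real.log_le_sub_one_of_pos hx0).trans (by linarith)
  have hh1 : 1 ≤ h := (one_le_div (by linarith)).mpr hlx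
  have hh4 : h ≤ x / 4 := by rw [hh]; gcongr
  set y := x - h with hy
  have hy34 : 3 / 4 * x ≤ y := by linarith
  have hye : Real.exp 2 ≤ y := by nlinarith
  have hy0 : 0 < y := (Real.exp_pos 2).trans_le hye
  have hyx : y ≤ x := by linarith
  set N := ⌊x⌋₊ + 1 with hN
  set M := ⌊y⌋₊ with hM
  have hMN : M + 1 ≤ N := Nat.succ_le_succ (Nat.floor_le_floor hyx)
  have h1 := abs_le.mp (hsum x (by nlinarith))
  have h2 := abs_le.mp (hsum y hye)
  rw [sum_mul_sub_eq_sum_mul_max _ hx0.le le_rfl] at h1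
  rw [sum_mul_sub_eq_sum_mul_max _ hy0.le hMN] at h2
  have hyx2 : K * y ^ 2 ≤ K * x ^ 2 := by gcongr
  set w : ℕ → ℝ := fun n ↦ max (x - n) 0 - max (y - n) 0 with hw
  have hw0 : ∀ n, 0 ≤ w n := fun n ↦ sub_nonneg.mpr (max_le_max_right _ (by linarith))
  have hwh : ∀ n, w n ≤ h := by
    intro n
    simp only [hw]
    rw [sub_le_iff_le_add]
    refine max_le ?_ ?_
    · linarith [le_max_left (y - n) 0]
    · linarith [le_max_right (y - n) 0]
  have hweq : ∀ n ∈ range (M + 1), w n = h := by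
    intro n hn
    have : (n : ℝ) ≤ y := (Nat.le_floor_iff hy0.le).mp (Nat.lt_succ_iff.mp (mem_range.mp hn))
    simp only [hw]
    rw [max_eq_left (by linarith), max_eq_left (by linarith), hy]
    ring
  have hdiff : -(2 * K * x ^ 2) ≤ ∑ n ∈ range N, mangoldtErrorCoeff n * w n := by
    have : ∑ n ∈ range N, mangoldtErrorCoeff n * w n =
        ∑ n ∈ range N, mangoldtErrorCoeff n * max (x - n) 0 -
          ∑ n ∈ range N, mangoldtErrorCoeff n * max (y - n) 0 := by
      rw [← sum_sub_distrib]
      exact sum_congr rfl fun n _ ↦ by simp only [hw]; ring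
    rw [this]
    linarith [h1.1, h2.2]
  have hsplit : ∑ n ∈ range N, mangoldtErrorCoeff n * w n =
      ∑ n ∈ range N, vonMangoldt n * (Real.log n ^ 2 * w n) -
        ∑ n ∈ range N, Real.log n ^ 2 * w n := by
    rw [← sum_sub_distrib]
    exact sum_congr rfl fun n _ ↦ by simp only [mangoldtErrorCoeff]; ring
  -- Since Λ ≥ 0, the factors log² n and `w n` may be replaced by their maxima.
  have hup : ∑ n ∈ range N, vonMangoldt n * (Real.log n ^ 2 * w n) ≤
      Chebyshev.psi x * (l ^ 2 * h) := by
    rw [psi_eq_sum_range, sum_mul]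
    refine sum_le_sum fun n hn ↦ ?_
    have hnx : (n : ℝ) ≤ x := (Nat.le_floor_iff hx0.le).mp (Nat.lt_succ_iff.mp (mem_range.mp hn))
    have hlog : Real.log n ≤ l := by
      rcases n.eq_zero_or_pos with rfl | hn0
      · simp; linarith
      · exact Real.log_le_log (by exact_mod_cast hn0) hnx
    have := Real.log_natCast_nonneg n
    have := hwh n
    have := hw0 n
    have := vonMangoldt_nonneg (n := n)
    gcongr
  have hMy : y - 1 ≤ M := by linarith [Nat.lt_floor_add_one y]
  have hMy' : (M : ℝ) ≤ y := Nat.floor_le hy0.le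
  have hM4 : x / 4 ≤ M := by nlinarith
  have hM0 : M ≠ 0 := by
    rintro h0
    rw [h0] at hM4
    push_cast at hM4
    linarith
  have hlow : (M * l ^ 2 - 2 * M * l * (1 + Real.log 4)) * h ≤
      ∑ n ∈ range N, Real.log n ^ 2 * w n := by
    calc (M * l ^ 2 - 2 * M * l * (1 + Real.log 4)) * h
        ≤ (∑ n ∈ range (M + 1), Real.log n ^ 2) * h := by
          gcongr
          refine le_trans ?_ (le_sum_log_sq hM0 l (by linarith))
          have : l - Real.log 4 ≤ Real.log M := by
            rw [hl, ← Real.log_div hx0.ne' (by norm_num)]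
            exact Real.log_le_log (by positivity) hM4
          have : l * M * (l - Real.log 4) ≤ l * M * Real.log M := by gcongr
          nlinarith
      _ = ∑ n ∈ range (M + 1), Real.log n ^ 2 * w n := by
          rw [sum_mul]
          exact sum_congr rfl fun n hn ↦ by rw [hweq n hn]
      _ ≤ _ := sum_le_sum_of_subset_of_nonneg (range_subset_range.mpr hMN)
          fun n _ _ ↦ mul_nonneg (sq_nonneg _) (hw0 n)
  have hmain : (M * l ^ 2 - 2 * M * l * (1 + Real.log 4)) * h - 2 * K * x ^ 2 ≤
      Chebyshev.psi x * (l ^ 2 * h) := by linarith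
  have hl0 : 0 < l := by linarith
  have hh0 : 0 < h := by linarith
  have hxl : x = h * l := by rw [hh]; field_simp
  have hgoal : (M * l ^ 2 - 2 * M * l * (1 + Real.log 4)) * h - 2 * K * x ^ 2 =
      (M - 2 * M / l * (1 + Real.log 4) - 2 * K * h) * (l ^ 2 * h) := by
    rw [hxl]; field_simp
  rw [hgoal] at hmain
  have hfin := le_of_mul_le_mul_right hmain (by positivity)
  have hlog4 : 0 ≤ Real.log 4 := Real.log_nonneg (by norm_num)
  have hMl : 2 * M / l * (1 + Real.log 4) ≤ 2 * h * (1 + Real.log 4) := by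
    have : 2 * M / l ≤ 2 * h := by
      rw [hh, ← mul_div_assoc]
      gcongr
      linarith
    gcongr
  have : (4 + 2 * Real.log 4 + 2 * K) * x / l = (4 + 2 * Real.log 4 + 2 * K) * h := by
    rw [hh, mul_div_assoc]
  rw [this]
  nlinarith

lemma exists_sub_le_theta :
    ∃ C : ℝ, 0 < C ∧ ∀ x : ℝ, 1 < x → x - C * x / Real.log x ≤ Chebyshev.theta x := by
  obtain ⟨C, hC, hpsi⟩ := exists_sub_le_psi
  refine ⟨C + 64, by positivity, fun x hx ↦ ?_⟩
  have hx0 : 0 < x := by linarith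
  have hl0 : 0 < Real.log x := Real.log_pos hx
  rcases le_or_gt (Real.exp 4) x with h4 | h4
  · have h1 := hpsi x h4
    have h2 := Chebyshev.psi_sub_theta_le hx.le
    have h3 : √x * Real.log x ≤ 16 * x / Real.log x := by
      rw [le_div_iff₀ hl0]
      have h5 := Real.log_le_rpow_div hx0.le (ε := 1 / 4) (by norm_num)
      have h6 : (x ^ (1 / 4 : ℝ)) ^ 2 = √x := by
        rw [← Real.rpow_natCast, ← Real.rpow_mul hx0.le, Real.sqrt_eq_rpow]
        norm_num
      have h7 : Real.log x ^ 2 ≤ 16 * √x := by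
        rw [← h6]
        calc Real.log x ^ 2 ≤ (x ^ (1 / 4 : ℝ) / (1 / 4)) ^ 2 := by gcongr
          _ = _ := by ring
      calc √x * Real.log x * Real.log x = √x * Real.log x ^ 2 := by ring
        _ ≤ √x * (16 * √x) := by gcongr
        _ = 16 * (√x * √x) := by ring
        _ = 16 * x := by rw [Real.mul_self_sqrt hx0.le]
    have h8 : (C + 64) * x / Real.log x = C * x / Real.log x + 4 * (16 * x / Real.log x) := by
      ring
    rw [h8]
    have : 0 ≤ 16 * x / Real.log x := by positivity
    linarith
  -- Here log x ≤ 4 < C + 64, so the left side is negative.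
  · refine le_trans ?_ (Chebyshev.theta_nonneg x)
    rw [sub_nonpos, le_div_iff₀ hl0]
    have : Real.log x ≤ 4 := by
      rw [Real.log_le_iff_le_exp hx0]; exact h4.le
    nlinarith

end PsiBound

/-! ### Common divisors of the differences of a concordant sequence. -/

section Divisibility

open Finset Polynomial fwdDiff_aux

/-- The `i`-th difference with step `h` of an integer polynomial is divisible by `h ^ i`. -/
lemma pow_dvd_fwdDiff_iter_eval (h : ℕ) (i : ℕ) (P : ℤ[X]) (x : ℕ) :
    (h : ℤ) ^ i ∣ (fwdDiff h)^[i] (fun n : ℕ ↦ P.eval (n : ℤ)) x := by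
  induction i generalizing P with
  | zero => simp
  | succ i ih =>
    -- With P regarded as a polynomial over ℤ[X], the difference of its values at X + h and X is
    -- divisible by h. Each difference thus extracts one factor h and leaves an integer polynomial.
    obtain ⟨Q, hQ⟩ : ∃ Q : ℤ[X], P.comp (X + C (h : ℤ)) - P = C (h : ℤ) * Q := by
      have := Polynomial.sub_dvd_eval_sub (X + C (h : ℤ)) X (P.map (C : ℤ →+* ℤ[X]))
      rw [add_sub_cancel_left, eval_map, eval_map] at this
      obtain ⟨Q, hQ⟩ := this
      refine ⟨Q, ?_⟩
      rw [← hQ, Polynomial.eval₂_C_X]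
      rfl
    have hdiff : fwdDiff h (fun n : ℕ ↦ P.eval (n : ℤ)) =
        (h : ℤ) • fun n : ℕ ↦ Q.eval (n : ℤ) := by
      ext n
      have := congrArg (eval (n : ℤ)) hQ
      simp only [eval_sub, eval_comp, eval_add, eval_X, eval_C, eval_mul] at this
      simpa [fwdDiff] using this
    rw [Function.iterate_succ_apply, hdiff, fwdDiff_iter_const_smul, pow_succ']
    exact mul_dvd_mul_left _ (ih Q)

variable {k : ℕ} {g : ℕ → ℤ}

lemma pow_dvd_fwdDiff_iter_of_concordant
    (hg : ∀ m : Fin (k + 1) → ℕ, ∃ P : ℤ[X], ∀ i, P.eval (m i : ℤ) = g (m i))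
    (h : ℕ) {i : ℕ} (hi : i ≤ k) (x : ℕ) : (h : ℤ) ^ i ∣ (fwdDiff h)^[i] g x := by
  obtain ⟨P, hP⟩ := hg fun j ↦ x + (j : ℕ) • h
  have : (fwdDiff h)^[i] g x = (fwdDiff h)^[i] (fun n : ℕ ↦ P.eval (n : ℤ)) x := by
    rw [fwdDiff_iter_eq_sum_shift, fwdDiff_iter_eq_sum_shift]
    refine sum_congr rfl fun j hj ↦ ?_
    have := hP ⟨j, by have := mem_range.mp hj; omega⟩
    simp only at this ⊢
    rw [this]
  rw [this]
  exact pow_dvd_fwdDiff_iter_eval h i P x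

/-- Substituting Δ for X turns identities in ℤ[X] into operator identities; 1 + Δ is the shift. -/
lemma aeval_fwdDiff_add_one_pow_sub_one (h : ℕ) :
    aeval (fwdDiffₗ ℕ ℤ 1) ((X + 1) ^ h - 1 : ℤ[X]) = fwdDiffₗ ℕ ℤ h := by
  have hs : fwdDiffₗ ℕ ℤ 1 + 1 = shiftₗ ℕ ℤ 1 := rfl
  have hpow : ∀ h : ℕ, ∀ (G : ℕ → ℤ) (x : ℕ), (shiftₗ ℕ ℤ 1 ^ h) G x = G (x + h) := by
    intro h G x
    rw [shiftₗ_pow_apply]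
    simp
  ext G x
  simp only [map_sub, map_pow, map_add, aeval_X, map_one, hs, LinearMap.sub_apply, Pi.sub_apply,
    hpow]
  rfl

/-- Linear operators preserve divisibility of all values of a sequence. -/
lemma dvd_aeval_apply {G : ℕ → ℤ} {d : ℤ} (hG : ∀ x, d ∣ G x) (A : Module.End ℤ (ℕ → ℤ)) (x : ℕ) :
    d ∣ A G x := by
  choose G' hG' using hG
  have : G = d • G' := by ext x; simpa using hG' x
  rw [this, map_smul]
  exact ⟨_, rfl⟩

lemma prime_pow_dvd_fwdDiff_iter
    (hg : ∀ m : Fin (k + 1) → ℕ, ∃ P : ℤ[X], ∀ i, P.eval (m i : ℤ) = g (m i))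
    {p : ℕ} (hp : p.Prime) {n j : ℕ} (hj : j ≤ k) (hn : p * j ≤ n) (x : ℕ) :
    (p : ℤ) ^ j ∣ (fwdDiff 1)^[n] g x := by
  obtain ⟨R, hR⟩ := exists_add_pow_prime_eq hp (X : ℤ[X]) 1
  set D := fwdDiffₗ ℕ ℤ 1 with hD
  have hX : (X : ℤ[X]) ^ p = ((X + 1) ^ p - 1) - C (p : ℤ) * (X * R) := by
    rw [hR]; simp; ring
  -- Induction trades factors Δ^p for differences of step p: each trade gives either one more such
  -- difference or an explicit factor p. The exponent i + l is preserved both ways.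
  have key : ∀ l i : ℕ, i + l ≤ k → ∀ x, (p : ℤ) ^ (i + l) ∣
      aeval D ((X ^ p) ^ l * ((X + 1) ^ p - 1) ^ i : ℤ[X]) g x := by
    intro l
    induction l with
    | zero =>
      intro i hi x
      rw [pow_zero, one_mul, map_pow, hD, aeval_fwdDiff_add_one_pow_sub_one, add_zero,
        coe_fwdDiffₗ_pow]
      exact pow_dvd_fwdDiff_iter_of_concordant hg p (by omega) x
    | succ l ih =>
      intro i hi x
      have e : ((X : ℤ[X]) ^ p) ^ (l + 1) * ((X + 1) ^ p - 1) ^ i =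
          (X ^ p) ^ l * ((X + 1) ^ p - 1) ^ (i + 1) -
            C (p : ℤ) * ((X * R) * ((X ^ p) ^ l * ((X + 1) ^ p - 1) ^ i)) := by
        rw [pow_succ, pow_succ _ i]
        nth_rewrite 2 [hX]
        ring
      rw [e, map_sub, LinearMap.sub_apply, Pi.sub_apply]
      refine dvd_sub ?_ ?_
      · have := ih (i + 1) (by omega) x
        rwa [show i + 1 + l = i + (l + 1) by ring] at this
      · rw [map_mul, map_mul _ (X * R), aeval_C, Module.End.mul_apply, Module.End.mul_apply]
        have := dvd_aeval_apply (ih i (by omega)) (aeval D (X * R)) x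
        rw [← add_assoc, pow_succ']
        exact mul_dvd_mul_left _ this
  have h0 := key j 0 (by omega)
  rw [← coe_fwdDiffₗ_pow]
  have e : aeval D (X ^ n : ℤ[X]) = aeval D (X ^ (n - p * j) : ℤ[X]) *
      aeval D ((X ^ p) ^ j * ((X + 1) ^ p - 1) ^ 0 : ℤ[X]) := by
    rw [← map_mul, pow_zero, mul_one, ← pow_mul, ← pow_add, Nat.sub_add_cancel hn]
  rw [map_pow, aeval_X] at e
  rw [e, Module.End.mul_apply]
  simp only [zero_add] at h0
  exact dvd_aeval_apply h0 _ x

/-- The exponent of the prime `p` in the common divisor of the `n`-th differences. -/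
def primeExponent (k n p : ℕ) : ℕ := #{j ∈ Icc 1 k | j * p ≤ n}

lemma prod_prime_pow_dvd_fwdDiff_iter
    (hg : ∀ m : Fin (k + 1) → ℕ, ∃ P : ℤ[X], ∀ i, P.eval (m i : ℤ) = g (m i)) (n x : ℕ) :
    ((∏ p ∈ Ioc 0 n with p.Prime, p ^ primeExponent k n p : ℕ) : ℤ) ∣ (fwdDiff 1)^[n] g x := by
  push_cast
  refine Finset.prod_dvd_of_coprime ?_ ?_
  · intro p hp q hq hpq
    have hp' := (mem_filter.mp (mem_coe.mp hp)).2
    have hq' := (mem_filter.mp (mem_coe.mp hq)).2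
    exact (Nat.isCoprime_iff_coprime.mpr ((Nat.coprime_primes hp' hq').mpr hpq)).pow
  · intro p hp
    have hp' := (mem_filter.mp hp).2
    refine prime_pow_dvd_fwdDiff_iter hg hp' ?_ ?_ x
    · exact (card_filter_le _ _).trans (by simp)
    · have hsub : ({j ∈ Icc 1 k | j * p ≤ n} : Finset ℕ) ⊆ Icc 1 (n / p) := by
        intro j hj
        simp only [mem_filter, mem_Icc] at hj ⊢
        exact ⟨hj.1.1, (Nat.le_div_iff_mul_le hp'.pos).mpr hj.2⟩
      have := card_le_card hsub
      rw [Nat.card_Icc, Nat.add_sub_cancel] at this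
      rw [mul_comm]
      exact (Nat.le_div_iff_mul_le hp'.pos).mp this

/-- The exponent of p counts the j ≤ k with p ≤ n/j; interchanging the sums over p and j gives
θ(n/j). -/
lemma log_prod_prime_pow (k n : ℕ) :
    Real.log (∏ p ∈ Ioc 0 n with p.Prime, p ^ primeExponent k n p : ℕ) =
      ∑ j ∈ Icc 1 k, Chebyshev.theta ((n : ℝ) / j) := by
  have h1 : ∀ j ∈ Icc 1 k, Chebyshev.theta ((n : ℝ) / j) =
      ∑ p ∈ Ioc 0 n with p.Prime, if j * p ≤ n then Real.log p else 0 := by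
    intro j hj
    have hj0 : 0 < j := (mem_Icc.mp hj).1
    rw [Chebyshev.theta, Nat.floor_div_eq_div, ← sum_filter]
    refine sum_congr ?_ fun _ _ ↦ rfl
    ext p
    simp only [mem_filter, mem_Ioc, Nat.le_div_iff_mul_le hj0]
    constructor
    · rintro ⟨⟨a, b⟩, c⟩
      exact ⟨⟨⟨a, by nlinarith⟩, c⟩, by linarith⟩
    · rintro ⟨⟨⟨a, b⟩, c⟩, d⟩
      exact ⟨⟨a, by linarith⟩, c⟩
  rw [sum_congr rfl h1, sum_comm]
  push_cast
  rw [Real.log_prod]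
  · refine sum_congr rfl fun p _ ↦ ?_
    rw [Real.log_pow, primeExponent, ← sum_filter, sum_const, nsmul_eq_mul]
  · intro p hp
    have := (mem_filter.mp hp).2.pos
    positivity

lemma exists_harmonic_mul_sub_le_sum_theta (k : ℕ) :
    ∃ c : ℝ, 0 < c ∧ ∀ n : ℕ, 2 ≤ n →
      (harmonic k : ℝ) * n - c * n / Real.log n ≤ ∑ j ∈ Icc 1 k, Chebyshev.theta ((n : ℝ) / j) := by
  obtain ⟨C, hC, h⟩ := exists_sub_le_theta
  have hH : (harmonic k : ℝ) = ∑ j ∈ Icc 1 k, (1 / j : ℝ) := by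
    rw [harmonic_eq_sum_Icc]; push_cast; simp
  have hH0 : 0 ≤ (harmonic k : ℝ) := by rw [hH]; positivity
  have hk0 : 0 ≤ Real.log ((k : ℝ) ^ 2) := by exact_mod_cast Real.log_natCast_nonneg (k ^ 2)
  -- For n < k² the term with log(k²) makes the left side nonpositive. For n ≥ k², every j ≤ k has
  -- log(n/j) ≥ (log n)/2, so each of the k errors is at most 2Cn/log n. The final 1 keeps the
  -- constant positive.
  refine ⟨2 * C * k + harmonic k * Real.log (k ^ 2) + 1, by positivity, fun n hn ↦ ?_⟩
  have hn0 : (0 : ℝ) < n := by positivity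
  have hl : 0 < Real.log n := Real.log_pos (by exact_mod_cast hn)
  rcases lt_or_ge n (k ^ 2) with hk | hk
  · refine le_trans ?_ (sum_nonneg fun j _ ↦ Chebyshev.theta_nonneg _)
    rw [sub_nonpos, le_div_iff₀ hl]
    have : Real.log n ≤ Real.log (k ^ 2) := Real.log_le_log hn0 (by exact_mod_cast hk.le)
    calc (harmonic k : ℝ) * n * Real.log n ≤ harmonic k * n * Real.log (k ^ 2) := by gcongr
      _ = harmonic k * Real.log (k ^ 2) * n := by ring
      _ ≤ _ := by
        gcongr
        have : 0 ≤ 2 * C * k := by positivity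
        linarith
  · have hterm : ∀ j ∈ Icc 1 k, (1 / j : ℝ) * n - 2 * C * n / Real.log n ≤
        Chebyshev.theta ((n : ℝ) / j) := by
      intro j hj
      obtain ⟨hj1, hjk⟩ := mem_Icc.mp hj
      have hj1' : (1 : ℝ) ≤ j := by exact_mod_cast hj1
      have hj2 : (j : ℝ) ^ 2 ≤ n := by
        exact_mod_cast (Nat.pow_le_pow_left hjk 2).trans hk
      have hlj : 2 * Real.log j ≤ Real.log n := by
        have := Real.log_le_log (by positivity) hj2
        rwa [Real.log_pow] at this
      have hx : (1 : ℝ) < n / j := by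
        rw [one_lt_div (by linarith)]
        have : (2 : ℝ) ≤ n := by exact_mod_cast hn
        nlinarith
      refine le_trans ?_ (h _ hx)
      have hlog : Real.log n / 2 ≤ Real.log (n / j) := by
        rw [Real.log_div hn0.ne' (by positivity)]
        linarith
      have hnj : (n : ℝ) / j ≤ n := div_le_self hn0.le hj1'
      have : C * ((n : ℝ) / j) / Real.log (n / j) ≤ C * n / (Real.log n / 2) := by gcongr
      have e : C * (n : ℝ) / (Real.log n / 2) = 2 * C * n / Real.log n := by field_simp
      rw [e] at this
      have e2 : (1 / j : ℝ) * n = n / j := by ring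
      rw [e2]
      linarith
    refine le_trans ?_ (sum_le_sum hterm)
    rw [sum_sub_distrib, ← sum_mul, ← hH, sum_const, Nat.card_Icc, Nat.add_sub_cancel, nsmul_eq_mul]
    have : (k : ℝ) * (2 * C * n / Real.log n) ≤
        (2 * C * k + harmonic k * Real.log (k ^ 2) + 1) * n / Real.log n := by
      rw [← mul_div_assoc]
      gcongr ?_ / _
      have : 0 ≤ (harmonic k : ℝ) * Real.log (k ^ 2) * n := by positivity
      nlinarith
    linarith

end Divisibility

/-! ### Conclusion. -/

theorem mainTheorem3 (k : ℕ) (hk : 1 ≤ k) (f : ℝ → ℝ) (hf : IsConcordant k f) :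
    ∃ c : ℝ, 0 < c ∧ ∃ B : ℕ, 1 ≤ B ∧ ∀ a : ℕ, B ≤ a → ∀ n : ℕ, 2 ≤ n →
      (fwdDiff (1 : ℝ))^[n] f (a : ℝ) = 0 ∨
        Real.exp ((harmonic k : ℝ) * (n : ℝ) - c * (n : ℝ) / Real.log (n : ℝ)) ≤
          |(fwdDiff (1 : ℝ))^[n] f (a : ℝ)| := by
  obtain ⟨B, hB, hP⟩ := hf
  obtain ⟨c, hc, hsum⟩ := exists_harmonic_mul_sub_le_sum_theta k
  refine ⟨c, hc, B, hB, fun a ha n hn ↦ ?_⟩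
  -- Constant tuples show that f is integral beyond `B`. Translating by a gives a sequence g on ℕ
  -- that is concordant for all tuples, with no threshold.
  have hint : ∀ i : ℕ, ∃ z : ℤ, (z : ℝ) = f ((a + i : ℕ) : ℝ) := by
    intro i
    obtain ⟨P, hP⟩ := hP (fun _ ↦ a + i) fun _ ↦ by omega
    exact ⟨_, hP 0⟩
  choose g hg using hint
  have hconc : ∀ m : Fin (k + 1) → ℕ, ∃ P : Polynomial ℤ, ∀ i, P.eval (m i : ℤ) = g (m i) := by
    intro m
    obtain ⟨P, hP⟩ := hP (fun i ↦ a + m i) fun i ↦ by omega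
    refine ⟨P.comp (Polynomial.X + Polynomial.C (a : ℤ)), fun i ↦ ?_⟩
    have h1 := hP i
    rw [← hg] at h1
    have h2 : P.eval ((a + m i : ℕ) : ℤ) = g (m i) := by exact_mod_cast h1
    rw [← h2]
    simp [add_comm]
  have hcast : (fwdDiff (1 : ℝ))^[n] f (a : ℝ) = (((fwdDiff 1)^[n] g 0 : ℤ) : ℝ) := by
    rw [fwdDiff_iter_eq_sum_shift, fwdDiff_iter_eq_sum_shift]
    push_cast
    refine Finset.sum_congr rfl fun i _ ↦ ?_
    have := hg i
    push_cast at this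
    simp [this]
  have hdvd := prod_prime_pow_dvd_fwdDiff_iter hconc n 0
  rw [hcast]
  rcases eq_or_ne ((fwdDiff 1)^[n] g 0) 0 with h0 | h0
  · left
    rw [h0, Int.cast_zero]
  · right
    set D := ∏ p ∈ Finset.Ioc 0 n with p.Prime, p ^ primeExponent k n p with hD
    have hDle : (D : ℤ) ≤ |(fwdDiff 1)^[n] g 0| :=
      Int.le_of_dvd (abs_pos.mpr h0) ((dvd_abs _ _).mpr hdvd)
    have hDle' : (D : ℝ) ≤ |(((fwdDiff 1)^[n] g 0 : ℤ) : ℝ)| := by exact_mod_cast hDle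
    have hD0 : 0 < D := Finset.prod_pos fun p hp ↦ pow_pos (Finset.mem_filter.mp hp).2.pos _
    refine le_trans ?_ hDle'
    rw [← Real.le_log_iff_exp_le (by exact_mod_cast hD0), hD, log_prod_prime_pow]
    exact hsum n hn
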